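/- Let $q\ge 2$ be an integer, $\mathcal Q=\{0,1,\dots,q-1\}$ with addition $\oplus_q$ and subtraction $\ominus_q$ modulo $q$, and let $\mathcal Y_3$ be a finite set. A memoryless three-user multiaccess/degraded-broadcast (MA/DB) two-way channel is given by a transition probability $P_{Y_3|X_1,X_2,X_3}$ from $\mathcal Q^3$ to $\mathcal Y_3$ and two probability distributions $P_{Z_1},P_{Z_2}$ on $\mathcal Q$. At each time $i$, given the current inputs $X_{1,i},X_{2,i},X_{3,i}\in\mathcal Q$ of users 1, 2, 3, and independently of everything in the past, user 3 receives $Y_{3,i}\sim P_{Y_3|X_1,X_2,X_3}(\cdot|X_{1,i},X_{2,i},X_{3,i})$, user 1 receives $Y_{1,i}=X_{1,i}\oplus_q X_{3,i}\oplus_q Z_{1,i}$ and user 2 receives $Y_{2,i}=X_{2,i}\oplus_q X_{3,i}\oplus_q Z_{1,i}\oplus_q Z_{2,i}$, where $Z_{1,i}\sim P_{Z_1}$ and $Z_{2,i}\sim P_{Z_2}$ are independent of each other and of $Y_{3,i}$; that is, $$P(y_1,y_2,y_3|x_1,x_2,x_3)=P_{Y_3|X_1,X_2,X_3}(y_3|x_1,x_2,x_3)\,P_{Z_1}(y_1\ominus_q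 x_1\ominus_q x_3)\,P_{Z_2}(y_2\ominus_q x_2\ominus_q y_1\oplus_q x_1).$$ For rates $R_{13},R_{23},R_{31},R_{32}\ge 0$, an $(n,R_{13},R_{23},R_{31},R_{32})$ code consists of message sets $\mathcal M_{jk}=\{1,2,\dots,\lfloor 2^{nR_{jk}}\rfloor\}$ for $jk\in\{13,23,31,32\}$, encoding functions $f_{1,i},f_{2,i},f_{3,i}$ with $X_{1,i}=f_{1,i}(M_{13},Y_1^{i-1})$, $X_{2,i}=f_{2,i}(M_{23},Y_2^{i-1})$, $X_{3,i}=f_{3,i}(M_{31},M_{32},Y_3^{i-1})$ for $i=1,\dots,n$, and decoding functions $g_1,g_2,g_3$ with $\hat M_{31}=g_1(M_{13},Y_1^n)$, $\hat M_{32}=g_2(M_{23},Y_2^n)$, $(\hat M_{13},\hat M_{23})=g_3(M_{31},M_{32},Y_3^n)$. The four messages are independent, uniformly distributed on their message sets, and independent of the channel noise. The error probability $P_{\mathrm e}^{(n)}$ is the probability that at least one of the four estimates differs from the corresponding message. The quadruple $(R_{13},R_{23},R_{31},R_{32})$ is achievable if there is a sequence of $(n,R_{13},R_{23},R_{31},R_{32})$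 codes, $n=1,2,\dots$, with $\lim_{n\to\infty}P_{\mathrm e}^{(n)}=0$. For a joint distribution $P_{X_1,X_2,X_3,V}$ on $\mathcal Q^3\times\mathcal V$ with $\mathcal V$ finite, let $\mathcal R(P_{X_1,X_2,X_3,V})$ be the set of all quadruples $(R_{13},R_{23},R_{31},R_{32})$ of nonnegative reals with $$R_{13}\le I(X_1;Y_3|X_2,X_3),\quad R_{23}\le I(X_2;Y_3|X_1,X_3),\quad R_{13}+R_{23}\le I(X_1,X_2;Y_3|X_3),$$ $$R_{31}\le I(X_3;X_3\oplus_q Z_1|V),\quad R_{32}\le I(V;X_3\oplus_q Z_1\oplus_q Z_2),$$ where the mutual informations (in bits) are evaluated under $P_{X_1,X_2,X_3,V}\cdot P_{Y_3|X_1,X_2,X_3}\cdot P_{Z_1}\cdot P_{Z_2}$. Theorem. Every achievable rate quadruple of the channel belongs to $$\mathcal C_{\mathrm O}=\overline{\mathrm{co}}\Big(\bigcup_{P_{X_1,X_2,X_3,V}}\mathcal R(P_{X_1,X_2,X_3,V})\Big),$$ where the union is over all joint distributions $P_{X_1,X_2,X_3,V}$ with $|\mathcal V|\le q+1$, and $\overline{\mathrm{co}}$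 denotes the closure of the convex hull. -/

import Mathlib

/-! Finite probability: a probability mass function on a finite sample space `Ω` is an element `p` of
`stdSimplex ℝ Ω`; random variables are functions on `Ω`. All logarithms are to base 2. -/

namespace MADB

open Classical in
/-- The law of the random variable `X` under the mass function `p`. -/
noncomputable def law {Ω α : Type*} [Fintype Ω] (p : Ω → ℝ) (X : Ω → α) (a : α) : ℝ :=
  ∑ ω, if X ω = a then p ω else 0

/-- Shannon entropy `H(X)` in bits (with `0 log 0 = 0`). -/
noncomputable def entropy {Ω α : Type*} [Fintype Ω] [Fintype α] (p : Ω → ℝ) (X : Ω → α) : ℝ :=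
  -∑ a, law p X a * Real.logb 2 (law p X a)

/-- Conditional entropy `H(X|Z) = H(X,Z) - H(Z)`. -/
noncomputable def condEntropy {Ω α γ : Type*} [Fintype Ω] [Fintype α] [Fintype γ]
    (p : Ω → ℝ) (X : Ω → α) (Z : Ω → γ) : ℝ :=
  entropy p (fun ω => (X ω, Z ω)) - entropy p Z

/-- Mutual information `I(X;Y) = H(X) - H(X|Y)`. -/
noncomputable def mutualInfo {Ω α β : Type*} [Fintype Ω] [Fintype α] [Fintype β]
    (p : Ω → ℝ) (X : Ω → α) (Y : Ω → β) : ℝ :=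
  entropy p X - condEntropy p X Y

/-- Conditional mutual information `I(X;Y|Z) = H(X|Z) - H(X|Y,Z)`. -/
noncomputable def condMutualInfo {Ω α β γ : Type*} [Fintype Ω] [Fintype α] [Fintype β] [Fintype γ]
    (p : Ω → ℝ) (X : Ω → α) (Y : Ω → β) (Z : Ω → γ) : ℝ :=
  condEntropy p X Z - condEntropy p X (fun ω => (Y ω, Z ω))

/-- A memoryless three-user multiaccess/degraded-broadcast two-way channel. The alphabets of
`X₁, X₂, X₃, Y₁, Y₂, Z₁, Z₂` are `ZMod q`, the alphabet of `Y₃` is `𝒴`. -/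
structure Channel (q : ℕ) [NeZero q] (𝒴 : Type*) [Fintype 𝒴] where
  /-- `PY3 x₁ x₂ x₃ y₃ = P(Y₃ = y₃ | X₁ = x₁, X₂ = x₂, X₃ = x₃)` -/
  PY3 : ZMod q → ZMod q → ZMod q → 𝒴 → ℝ
  PZ1 : ZMod q → ℝ
  PZ2 : ZMod q → ℝ
  PY3_mem : ∀ x₁ x₂ x₃, PY3 x₁ x₂ x₃ ∈ stdSimplex ℝ 𝒴
  PZ1_mem : PZ1 ∈ stdSimplex ℝ (ZMod q)
  PZ2_mem : PZ2 ∈ stdSimplex ℝ (ZMod q)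

/-- The one-step transition probability `P(y₁, y₂, y₃ | x₁, x₂, x₃)` of the channel with
`Y₁ = X₁ + X₃ + Z₁` and `Y₂ = X₂ + X₃ + Z₁ + Z₂ = X₂ + (Y₁ - X₁) + Z₂`. -/
def Channel.transition {q : ℕ} [NeZero q] {𝒴 : Type*} [Fintype 𝒴] (W : Channel q 𝒴)
    (x₁ x₂ x₃ y₁ y₂ : ZMod q) (y₃ : 𝒴) : ℝ :=
  W.PY3 x₁ x₂ x₃ y₃ * W.PZ1 (y₁ - x₁ - x₃) * W.PZ2 (y₂ - x₂ - y₁ + x₁)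

/-- The message set `{1, 2, …, 2^{nR}}`, with `⌊2^{nR}⌋` elements. -/
abbrev Msg (n : ℕ) (R : ℝ) : Type := Fin ⌊(2 : ℝ) ^ ((n : ℝ) * R)⌋₊

/-- The symbols of `y` before time `i`. -/
def past {n : ℕ} {α : Type*} (y : Fin n → α) (i : Fin n) : Fin (i : ℕ) → α :=
  fun j => y ⟨j, j.2.trans i.2⟩

/-- An `(n, R₁₃, R₂₃, R₃₁, R₃₂)` channel code with feedback encoders and decoders. -/
structure Code (q : ℕ) (𝒴 : Type*) (n : ℕ) (R₁₃ R₂₃ R₃₁ R₃₂ : ℝ) where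
  f₁ : (i : Fin n) → Msg n R₁₃ → (Fin (i : ℕ) → ZMod q) → ZMod q
  f₂ : (i : Fin n) → Msg n R₂₃ → (Fin (i : ℕ) → ZMod q) → ZMod q
  f₃ : (i : Fin n) → Msg n R₃₁ → Msg n R₃₂ → (Fin (i : ℕ) → 𝒴) → ZMod q
  /-- estimate of `M₃₁` at user 1 -/
  g₁ : Msg n R₁₃ → (Fin n → ZMod q) → Msg n R₃₁
  /-- estimate of `M₃₂` at user 2 -/
  g₂ : Msg n R₂₃ → (Fin n → ZMod q) → Msg n R₃₂
  /-- estimate of `(M₁₃, M₂₃)` at user 3 -/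
  g₃ : Msg n R₃₁ → Msg n R₃₂ → (Fin n → 𝒴) → Msg n R₁₃ × Msg n R₂₃

section Code

variable {q : ℕ} [NeZero q] {𝒴 : Type*} [Fintype 𝒴] {n : ℕ} {R₁₃ R₂₃ R₃₁ R₃₂ : ℝ}

/-- The joint probability of the messages and the output sequences when the code is used over the
channel: the messages are independent and uniform, and the channel is memoryless. -/
noncomputable def jointProb (W : Channel q 𝒴) (c : Code q 𝒴 n R₁₃ R₂₃ R₃₁ R₃₂)
    (m₁₃ : Msg n R₁₃) (m₂₃ : Msg n R₂₃) (m₃₁ : Msg n R₃₁) (m₃₂ : Msg n R₃₂)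
    (y₁ y₂ : Fin n → ZMod q) (y₃ : Fin n → 𝒴) : ℝ :=
  (Fintype.card (Msg n R₁₃) : ℝ)⁻¹ * (Fintype.card (Msg n R₂₃) : ℝ)⁻¹ *
    (Fintype.card (Msg n R₃₁) : ℝ)⁻¹ * (Fintype.card (Msg n R₃₂) : ℝ)⁻¹ *
    ∏ i, W.transition (c.f₁ i m₁₃ (past y₁ i)) (c.f₂ i m₂₃ (past y₂ i))
      (c.f₃ i m₃₁ m₃₂ (past y₃ i)) (y₁ i) (y₂ i) (y₃ i)

/-- The probability that at least one of the four messages is decoded wrongly. -/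
noncomputable def errorProb (W : Channel q 𝒴) (c : Code q 𝒴 n R₁₃ R₂₃ R₃₁ R₃₂) : ℝ :=
  ∑ m₁₃, ∑ m₂₃, ∑ m₃₁, ∑ m₃₂, ∑ y₁, ∑ y₂, ∑ y₃,
    if (c.g₃ m₃₁ m₃₂ y₃).1 ≠ m₁₃ ∨ (c.g₃ m₃₁ m₃₂ y₃).2 ≠ m₂₃ ∨ c.g₁ m₁₃ y₁ ≠ m₃₁ ∨
        c.g₂ m₂₃ y₂ ≠ m₃₂
    then jointProb W c m₁₃ m₂₃ m₃₁ m₃₂ y₁ y₂ y₃ else 0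

/-- Achievability of a (nonnegative) rate quadruple: there is a sequence of codes, one for each
block length, whose error probability tends to zero. -/
def Achievable (W : Channel q 𝒴) (R₁₃ R₂₃ R₃₁ R₃₂ : ℝ) : Prop :=
  0 ≤ R₁₃ ∧ 0 ≤ R₂₃ ∧ 0 ≤ R₃₁ ∧ 0 ≤ R₃₂ ∧
    ∃ c : (n : ℕ) → Code q 𝒴 n R₁₃ R₂₃ R₃₁ R₃₂,
      Filter.Tendsto (fun n => errorProb W (c n)) Filter.atTop (nhds 0)

end Code

section Region

variable {q : ℕ} [NeZero q] {𝒴 𝒱 : Type*} [Fintype 𝒴] [Fintype 𝒱]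

/-- The values of `(X₁, X₂, X₃, V, Y₃, Z₁, Z₂)`. -/
structure Outcome (q : ℕ) (𝒴 𝒱 : Type*) where
  X₁ : ZMod q
  X₂ : ZMod q
  X₃ : ZMod q
  V : 𝒱
  Y₃ : 𝒴
  Z₁ : ZMod q
  Z₂ : ZMod q

/-- Outcomes are tuples. -/
def Outcome.equivProd (q : ℕ) (𝒴 𝒱 : Type*) :
    Outcome q 𝒴 𝒱 ≃ ZMod q × ZMod q × ZMod q × 𝒱 × 𝒴 × ZMod q × ZMod q where
  toFun ω := (ω.X₁, ω.X₂, ω.X₃, ω.V, ω.Y₃, ω.Z₁, ω.Z₂)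
  invFun t := ⟨t.1, t.2.1, t.2.2.1, t.2.2.2.1, t.2.2.2.2.1, t.2.2.2.2.2.1, t.2.2.2.2.2.2⟩
  left_inv _ := rfl
  right_inv _ := rfl

instance : Fintype (Outcome q 𝒴 𝒱) := Fintype.ofEquiv _ (Outcome.equivProd q 𝒴 𝒱).symm

/-- The joint law `P_{X₁,X₂,X₃,V} · P_{Y₃|X₁,X₂,X₃} · P_{Z₁} · P_{Z₂}`. -/
def Channel.outcomeProb (W : Channel q 𝒴) (P : ZMod q × ZMod q × ZMod q × 𝒱 → ℝ)
    (ω : Outcome q 𝒴 𝒱) : ℝ :=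
  P (ω.X₁, ω.X₂, ω.X₃, ω.V) * W.PY3 ω.X₁ ω.X₂ ω.X₃ ω.Y₃ * W.PZ1 ω.Z₁ * W.PZ2 ω.Z₂

/-- The set of nonnegative rate quadruples `(R₁₃, R₂₃, R₃₁, R₃₂)` that satisfy the multiple-access
and the degraded-broadcast constraints for the law `P` of `(X₁, X₂, X₃, V)`. -/
def rateRegion (W : Channel q 𝒴) (P : ZMod q × ZMod q × ZMod q × 𝒱 → ℝ) : Set (ℝ × ℝ × ℝ × ℝ) :=
  {(R₁₃, R₂₃, R₃₁, R₃₂) : ℝ × ℝ × ℝ × ℝ |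
    0 ≤ R₁₃ ∧ 0 ≤ R₂₃ ∧ 0 ≤ R₃₁ ∧ 0 ≤ R₃₂ ∧
    -- I(X₁; Y₃ | X₂, X₃)
    R₁₃ ≤ condMutualInfo (W.outcomeProb P) (·.X₁) (·.Y₃) (fun ω => (ω.X₂, ω.X₃)) ∧
    -- I(X₂; Y₃ | X₁, X₃)
    R₂₃ ≤ condMutualInfo (W.outcomeProb P) (·.X₂) (·.Y₃) (fun ω => (ω.X₁, ω.X₃)) ∧
    -- I(X₁, X₂; Y₃ | X₃)
    R₁₃ + R₂₃ ≤ condMutualInfo (W.outcomeProb P) (fun ω => (ω.X₁, ω.X₂)) (·.Y₃) (·.X₃) ∧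
    -- I(X₃; X₃ + Z₁ | V)
    R₃₁ ≤ condMutualInfo (W.outcomeProb P) (·.X₃) (fun ω => ω.X₃ + ω.Z₁) (·.V) ∧
    -- I(V; X₃ + Z₁ + Z₂)
    R₃₂ ≤ mutualInfo (W.outcomeProb P) (·.V) (fun ω => ω.X₃ + ω.Z₁ + ω.Z₂)}

/-- The outer bound: the closure of the convex hull of the union of the rate regions over all joint
laws of `(X₁, X₂, X₃, V)`, the alphabet of `V` having at most `q + 1` elements. -/
def outerBound (W : Channel q 𝒴) : Set (ℝ × ℝ × ℝ × ℝ) :=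
  closure (convexHull ℝ {R | ∃ k ≤ q + 1,
    ∃ P ∈ stdSimplex ℝ (ZMod q × ZMod q × ZMod q × Fin k), R ∈ rateRegion W P})

end Region

end MADB

/-! Users 1 and 2 receive sums modulo q: once a user's own input is known, its output is equivalent
to X₃ plus noise. Feedback can make the inputs depend on each other, but the region already allows
every joint law of the inputs. Each rate bound comes from Fano's inequality and the chain rule
(`condEntropy_le_sum`), after the decoder is given suitable extra information.

Multiple access (`mac_converse`): user 3 is also given the noise. From M₃₁, M₃₂ and the message of
user 1 or 2, the past of (Y₃, Z₁, Z₂) recursively reproduces the inputs of user 3 and of that user.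
The noise is independent of the messages and the past, so its entropy appears in both terms and
cancels; what remains is H(Y₃ | known inputs) - H(Y₃ | X₁, X₂, X₃).

Broadcast (`broadcast_converse₁`, `broadcast_converse₂`): the auxiliary variable at time i consists
of M₁₃, M₂₃, M₃₂ and the past of Y₁ and Y₂. It determines X₁ and X₂, so Y₁ and Y₂ may be exchanged
for X₃ + Z₁ and X₃ + Z₁ + Z₂. For M₃₁, user 1 is also given Y₂, M₂₃ and M₃₂. For M₃₂, user 2 is
given M₁₃.

A uniform time index, made part of V, turns the sums over time into one joint law
(`exists_single_letter`); concavity of conditional entropy in the law handles the terms that do not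
involve V, so a single region suffices for each block length. A Carathéodory argument shrinks V
(`exists_small_aux`): the law of X₃ and H(X₃ + Z₁ | V) are q + 1 linear quantities to keep, whereas
H(X₃ + Z₁ + Z₂ | V) only must not grow. The rates, reduced by a vanishing amount, then lie in a
region of the union, and the closure absorbs the loss. -/

namespace MADB

open Finset Real

/-! ### Entropy inequalities on finite probability spaces -/

section EntropyLibrary

variable {Ω α β γ δ τ : Type*} [Fintype Ω] [Fintype α] [Fintype β] [Fintype γ] [Fintype δ]
  [Fintype τ] {p : Ω → ℝ}

omit [Fintype α] in
lemma law_nonneg (hp : ∀ ω, 0 ≤ p ω) (X : Ω → α) (a : α) : 0 ≤ law p X a := by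
  unfold law
  exact sum_nonneg fun ω _ => by split_ifs <;> simp [hp]

omit [Fintype α] in
lemma le_law (hp : ∀ ω, 0 ≤ p ω) (X : Ω → α) (ω : Ω) : p ω ≤ law p X (X ω) := by
  classical
  unfold law
  refine le_trans (by simp) (single_le_sum (f := fun ω' => if X ω' = X ω then p ω' else 0)
    (fun ω' _ => by split_ifs <;> simp [hp]) (mem_univ ω))

lemma sum_law_mul (p : Ω → ℝ) (X : Ω → α) (F : α → ℝ) :
    ∑ a, law p X a * F a = ∑ ω, p ω * F (X ω) := by
  classical
  simp only [law, sum_mul, ite_mul, zero_mul]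
  rw [sum_comm]
  exact sum_congr rfl fun ω _ => by simp

lemma sum_law (p : Ω → ℝ) (X : Ω → α) : ∑ a, law p X a = ∑ ω, p ω := by
  simpa using sum_law_mul p X fun _ => 1

/-- An expectation over the sample space makes entropies of variables with different alphabets
comparable term by term. -/
lemma entropy_eq (p : Ω → ℝ) (X : Ω → α) :
    entropy p X = -∑ ω, p ω * logb 2 (law p X (X ω)) := by
  rw [entropy, sum_law_mul p X fun a => logb 2 (law p X a)]

omit [Fintype α] [Fintype β] in
lemma law_congr {X : Ω → α} {Y : Ω → β} {a : α} {b : β} (h : ∀ ω, X ω = a ↔ Y ω = b) :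
    law p X a = law p Y b := by
  unfold law
  exact sum_congr rfl fun ω _ => by by_cases hb : Y ω = b <;> simp [h, hb]

/-- Random variables that generate the same partition have the same entropy. -/
lemma entropy_congr {X : Ω → α} {Y : Ω → β} (h : ∀ ω ω', X ω = X ω' ↔ Y ω = Y ω') :
    entropy p X = entropy p Y := by
  simp only [entropy_eq, law_congr fun ω' => h ω' _]

/-- Agreement of the two partitions is needed only inside the cells of the conditioning variable.
This is what allows an output to be traded for noise when the inputs are functions of the condition.
-/
lemma condEntropy_congr {X : Ω → α} {Y : Ω → β} {Z : Ω → γ} {T : Ω → δ}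
    (hZ : ∀ ω ω', Z ω = Z ω' ↔ T ω = T ω')
    (h : ∀ ω ω', Z ω = Z ω' → (X ω = X ω' ↔ Y ω = Y ω')) :
    condEntropy p X Z = condEntropy p Y T := by
  rw [condEntropy, condEntropy, entropy_congr hZ, entropy_congr (Y := fun ω => (Y ω, T ω))]
  intro ω ω'
  simp only [Prod.mk.injEq, ← hZ]
  exact ⟨fun a => ⟨(h _ _ a.2).1 a.1, a.2⟩, fun a => ⟨(h _ _ a.2).2 a.1, a.2⟩⟩

/-- Gibbs' inequality: the conditional entropy is at most the cross entropy with respect to any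
subnormalised conditional law. -/
lemma condEntropy_le_crossEntropy (hp : ∀ ω, 0 ≤ p ω) (X : Ω → α) (Y : Ω → β) (Q : α → β → ℝ)
    (hQ0 : ∀ a b, 0 ≤ Q a b) (hQ1 : ∀ b, ∑ a, Q a b ≤ 1)
    (hpos : ∀ ω, 0 < p ω → 0 < Q (X ω) (Y ω)) :
    condEntropy p X Y ≤ -∑ ω, p ω * logb 2 (Q (X ω) (Y ω)) := by
  set J : Ω → ℝ := fun ω => law p (fun ω => (X ω, Y ω)) (X ω, Y ω) with hJ
  -- The pointwise bound log t ≤ t - 1 at t = Q(X|Y) P(Y) / P(X,Y); points of mass zero contribute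
  -- nothing.
  have key : ∀ ω, p ω * logb 2 (Q (X ω) (Y ω)) + p ω * logb 2 (law p Y (Y ω)) -
      p ω * logb 2 (J ω) ≤
      (p ω * (Q (X ω) (Y ω) * law p Y (Y ω) / J ω) - p ω) / log 2 := by
    intro ω
    rcases (hp ω).eq_or_lt with h0 | h0
    · simp [← h0]
    have hY := h0.trans_le (le_law hp Y ω)
    have hXY := h0.trans_le (le_law hp (fun ω => (X ω, Y ω)) ω)
    have hQ := hpos ω h0
    have hl : 0 < log 2 := log_pos (by norm_num)
    have := log_le_sub_one_of_pos (div_pos (mul_pos hQ hY) hXY)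
    rw [log_div (mul_pos hQ hY).ne' hXY.ne', log_mul hQ.ne' hY.ne'] at this
    simp only [logb, hJ]
    rw [le_div_iff₀ hl]
    field_simp
    field_simp at this
    nlinarith
  have hs : ∑ ω, p ω * (Q (X ω) (Y ω) * law p Y (Y ω) / J ω) ≤ ∑ ω, p ω := by
    rw [← sum_law_mul p (fun ω => (X ω, Y ω))
      fun c => Q c.1 c.2 * law p Y c.2 / law p (fun ω => (X ω, Y ω)) c]
    calc _ ≤ ∑ c : α × β, Q c.1 c.2 * law p Y c.2 := by
          refine sum_le_sum fun c _ => ?_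
          have h1 := mul_nonneg (hQ0 c.1 c.2) (law_nonneg hp Y c.2)
          rcases (law_nonneg hp (fun ω => (X ω, Y ω)) c).eq_or_lt with h0 | h0
          · rw [← h0]; simpa using h1
          · rw [mul_div_cancel₀ _ h0.ne']
      _ = ∑ b, (∑ a, Q a b) * law p Y b := by
          rw [Fintype.sum_prod_type_right]
          simp [sum_mul]
      _ ≤ ∑ b, law p Y b := sum_le_sum fun b _ =>
          mul_le_of_le_one_left (law_nonneg hp Y b) (hQ1 b)
      _ = _ := sum_law p Y
  have h2 := sum_le_sum fun ω (_ : ω ∈ univ) => key ω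
  rw [← sum_div, sum_sub_distrib, sum_sub_distrib, sum_add_distrib] at h2
  have h3 : (∑ ω, p ω * (Q (X ω) (Y ω) * law p Y (Y ω) / J ω) - ∑ ω, p ω) / log 2 ≤ 0 :=
    div_nonpos_of_nonpos_of_nonneg (by linarith) (log_pos (by norm_num)).le
  rw [condEntropy, entropy_eq, entropy_eq]
  simp only [hJ] at h2 h3
  linarith

/-- Conditioning on more reduces entropy. -/
lemma condEntropy_anti (hp : ∀ ω, 0 ≤ p ω) (X : Ω → α) {Y : Ω → β} {Z : Ω → γ}
    (h : ∀ ω ω', Y ω = Y ω' → Z ω = Z ω') : condEntropy p X Y ≤ condEntropy p X Z := by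
  classical
  -- `Z` is a function of `Y`, so adjoining it to the condition changes nothing; Gibbs' inequality
  -- is then applied with the conditional law of `X` given `Z`.
  rw [condEntropy_congr (Y := X) (T := fun ω => (Y ω, Z ω))
    (by simp only [Prod.mk.injEq]; grind) (by simp)]
  refine (condEntropy_le_crossEntropy hp X (fun ω => (Y ω, Z ω))
    (fun a c => law p (fun ω => (X ω, Z ω)) (a, c.2) / law p Z c.2)
    (fun a b => div_nonneg (law_nonneg hp _ _) (law_nonneg hp _ _)) ?_ ?_).trans_eq ?_
  · intro c
    rw [← sum_div]
    refine div_le_one_of_le₀ (le_of_eq ?_) (law_nonneg hp _ _)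
    simp only [law]
    rw [sum_comm]
    refine sum_congr rfl fun ω _ => ?_
    by_cases hz : Z ω = c.2 <;> simp [hz]
  · intro ω h0
    exact div_pos (h0.trans_le (le_law hp (fun ω => (X ω, Z ω)) ω)) (h0.trans_le (le_law hp Z ω))
  · rw [condEntropy, entropy_eq, entropy_eq, ← sub_eq_zero]
    simp only [← sum_neg_distrib, ← sum_sub_distrib]
    refine sum_eq_zero fun ω _ => ?_
    rcases (hp ω).eq_or_lt with h0 | h0
    · simp [← h0]
    rw [logb_div (h0.trans_le (le_law hp (fun ω => (X ω, Z ω)) ω)).ne'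
      (h0.trans_le (le_law hp Z ω)).ne']
    ring

lemma condEntropy_pair (X : Ω → α) (Y : Ω → β) (Z : Ω → γ) :
    condEntropy p (fun ω => (X ω, Y ω)) Z =
      condEntropy p X Z + condEntropy p Y (fun ω => (X ω, Z ω)) := by
  have : entropy p (fun ω => ((X ω, Y ω), Z ω)) = entropy p (fun ω => (Y ω, X ω, Z ω)) :=
    entropy_congr (by simp only [Prod.mk.injEq]; grind)
  simp only [condEntropy, this]
  ring

lemma condMutualInfo_symm (X : Ω → α) (Y : Ω → β) (Z : Ω → γ) :
    condMutualInfo p X Y Z = condEntropy p Y Z - condEntropy p Y (fun ω => (X ω, Z ω)) := by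
  have : entropy p (fun ω => (X ω, Y ω, Z ω)) = entropy p (fun ω => (Y ω, X ω, Z ω)) :=
    entropy_congr (by simp only [Prod.mk.injEq]; grind)
  simp only [condMutualInfo, condEntropy, this]
  ring

lemma condMutualInfo_nonneg (hp : ∀ ω, 0 ≤ p ω) (X : Ω → α) (Y : Ω → β) (Z : Ω → γ) :
    0 ≤ condMutualInfo p X Y Z :=
  sub_nonneg.2 (condEntropy_anti hp X (by simp))

lemma mutualInfo_symm (X : Ω → α) (Y : Ω → β) :
    mutualInfo p X Y = entropy p Y - condEntropy p Y X := by
  have : entropy p (fun ω => (X ω, Y ω)) = entropy p (fun ω => (Y ω, X ω)) :=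
    entropy_congr (by simp only [Prod.mk.injEq]; grind)
  simp only [mutualInfo, condEntropy, this]
  ring

lemma entropy_const (hp1 : ∑ ω, p ω = 1) {X : Ω → α} (h : ∀ ω ω', X ω = X ω') :
    entropy p X = 0 := by
  have : ∀ ω, law p X (X ω) = 1 := fun ω => by simp [law, fun ω' => h ω' ω, hp1]
  simp [entropy_eq, this]

lemma condEntropy_const (hp1 : ∑ ω, p ω = 1) (X : Ω → α) {Z : Ω → γ} (h : ∀ ω ω', Z ω = Z ω') :
    condEntropy p X Z = entropy p X := by
  rw [condEntropy, entropy_const hp1 h, sub_zero]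
  exact entropy_congr (by simp only [Prod.mk.injEq]; grind)

lemma condEntropy_le_entropy (hp : ∀ ω, 0 ≤ p ω) (hp1 : ∑ ω, p ω = 1) (X : Ω → α) (Z : Ω → γ) :
    condEntropy p X Z ≤ entropy p X := by
  rw [← condEntropy_const hp1 X (Z := fun _ => ()) (by simp)]
  exact condEntropy_anti hp X (by simp)

lemma mutualInfo_nonneg (hp : ∀ ω, 0 ≤ p ω) (hp1 : ∑ ω, p ω = 1) (X : Ω → α) (Y : Ω → β) :
    0 ≤ mutualInfo p X Y :=
  sub_nonneg.2 (condEntropy_le_entropy hp hp1 X Y)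

lemma entropy_le_logb_card (hp : ∀ ω, 0 ≤ p ω) (hp1 : ∑ ω, p ω = 1) (X : Ω → α) :
    entropy p X ≤ logb 2 (Fintype.card α) := by
  rw [← condEntropy_const hp1 X (Z := fun _ => ()) (by simp)]
  have hne : Nonempty α := by
    by_contra h
    rw [not_nonempty_iff] at h
    have : IsEmpty Ω := Function.isEmpty X
    simp at hp1
  have hc : (0 : ℝ) < Fintype.card α := by exact_mod_cast Fintype.card_pos
  refine (condEntropy_le_crossEntropy hp X (fun _ => ()) (fun _ _ => (Fintype.card α : ℝ)⁻¹)
    (fun _ _ => by positivity) (fun _ => by simp [hc.ne']) fun _ _ => by positivity).trans_eq ?_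
  simp [logb_inv, ← sum_mul, hp1]

/-- Fano's inequality. -/
lemma condEntropy_le_fano (hp : ∀ ω, 0 ≤ p ω) (hp1 : ∑ ω, p ω = 1) (X : Ω → α) (Y : Ω → β)
    (g : β → α) {E : ℝ} [DecidableEq α]
    (hE : ∑ ω, (if X ω ≠ g (Y ω) then p ω else 0) ≤ E) :
    condEntropy p X Y ≤ 1 + E * logb 2 (Fintype.card α) := by
  have hne : Nonempty α := by
    by_contra h
    rw [not_nonempty_iff] at h
    have : IsEmpty Ω := Function.isEmpty X
    simp at hp1
  have hc : (1 : ℝ) ≤ Fintype.card α := by exact_mod_cast Fintype.card_pos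
  have hc0 : (0 : ℝ) < Fintype.card α := by linarith
  -- The reference law mixes, with weights one half, the point mass at the guess and the uniform
  -- law: a correct guess costs at most one bit, a wrong one exactly one bit more than the logarithm
  -- of the alphabet size.
  refine (condEntropy_le_crossEntropy hp X Y
    (fun a b => (if a = g b then 2⁻¹ else 0) + (2 * Fintype.card α : ℝ)⁻¹) (fun a b => ?_)
    (fun b => ?_) (fun ω _ => ?_)).trans ?_
  · split_ifs <;> positivity
  · rw [sum_add_distrib]
    simp only [sum_ite_eq', mem_univ, if_true, sum_const, card_univ, nsmul_eq_mul]
    field_simp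
    norm_num
  · split_ifs <;> positivity
  · have : ∀ ω, -(p ω * logb 2 ((if X ω = g (Y ω) then 2⁻¹ else 0) +
        (2 * Fintype.card α : ℝ)⁻¹)) ≤
        p ω + (if X ω ≠ g (Y ω) then p ω else 0) * logb 2 (Fintype.card α) := by
      intro ω
      by_cases h : X ω = g (Y ω)
      · have h1 : logb 2 (2⁻¹ : ℝ) ≤ logb 2 (2⁻¹ + (2 * Fintype.card α : ℝ)⁻¹) :=
          logb_le_logb_of_le (by norm_num) (by norm_num) (by
            have : (0 : ℝ) < (2 * Fintype.card α : ℝ)⁻¹ := by positivity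
            linarith)
        rw [logb_inv, logb_self_eq_one (by norm_num)] at h1
        simp only [h, if_true, ne_eq, not_true_eq_false, if_false]
        nlinarith [hp ω]
      · simp only [h, if_false, zero_add, ne_eq, not_false_eq_true, if_true]
        rw [logb_inv, logb_mul (by norm_num) hc0.ne', logb_self_eq_one (by norm_num)]
        exact le_of_eq (by ring)
    rw [← sum_neg_distrib]
    refine (sum_le_sum fun ω _ => this ω).trans ?_
    rw [sum_add_distrib, hp1, ← sum_mul]
    have := mul_le_mul_of_nonneg_right hE (logb_nonneg (b := 2) (by norm_num) hc)
    linarith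

/-- The entropy of a mass function. -/
noncomputable def massEntropy (κ : τ → ℝ) : ℝ := -∑ t, κ t * logb 2 (κ t)

/-- The conditional entropy of `T` given `A` when the conditional law of `T` given `A` is `κ`. -/
lemma condEntropy_eq_of_condLaw (hp : ∀ ω, 0 ≤ p ω) (A : Ω → α) (T : Ω → τ) (κ : Ω → τ → ℝ)
    (hκ : ∀ ω ω', A ω = A ω' → κ ω = κ ω')
    (hG : ∀ G : α → τ → ℝ, ∑ ω, p ω * G (A ω) (T ω) = ∑ ω, p ω * ∑ t, κ ω t * G (A ω) t) :
    condEntropy p T A = ∑ ω, p ω * massEntropy (κ ω) := by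
  classical
  have hlaw : ∀ ω t, law p (fun ω => (T ω, A ω)) (t, A ω) = law p A (A ω) * κ ω t := by
    intro ω t
    -- An indicator as test function reads off the joint law.
    have := hG fun a s => if s = t ∧ a = A ω then 1 else 0
    simp only [mul_ite, mul_one, mul_zero, ite_and] at this
    simp only [law, Prod.mk.injEq, ite_and, sum_mul]
    convert this using 1
    refine sum_congr rfl fun ω' _ => ?_
    by_cases h : A ω' = A ω
    · simp [h, hκ ω' ω h]
    · simp [h]
  -- The logarithm of the conditional law as test function turns the left side into minus the
  -- conditional entropy.
  have h1 := hG fun a t => logb 2 (law p (fun ω => (T ω, A ω)) (t, a)) - logb 2 (law p A a)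
  have h2 : ∑ ω, p ω * ∑ t, κ ω t *
      (logb 2 (law p (fun ω => (T ω, A ω)) (t, A ω)) - logb 2 (law p A (A ω))) =
      ∑ ω, p ω * -massEntropy (κ ω) := by
    refine sum_congr rfl fun ω _ => ?_
    rcases (hp ω).eq_or_lt with h0 | h0
    · simp [← h0]
    rw [massEntropy, neg_neg]
    congr 1
    refine sum_congr rfl fun t _ => ?_
    by_cases hk : κ ω t = 0
    · simp [hk]
    rw [hlaw, logb_mul (h0.trans_le (le_law hp A ω)).ne' hk]
    ring
  rw [h2] at h1
  rw [condEntropy, entropy_eq, entropy_eq]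
  simp only [mul_sub, sum_sub_distrib, mul_neg, sum_neg_distrib] at h1
  linarith

lemma massEntropy_mul {κ : α → ℝ} {η : β → ℝ} (hκ : ∑ a, κ a = 1) (hη : ∑ b, η b = 1) :
    massEntropy (fun c : α × β => κ c.1 * η c.2) = massEntropy κ + massEntropy η := by
  have : ∀ c : α × β, κ c.1 * η c.2 * logb 2 (κ c.1 * η c.2) =
      (κ c.1 * logb 2 (κ c.1)) * η c.2 + κ c.1 * (η c.2 * logb 2 (η c.2)) := by
    intro c
    by_cases h1 : κ c.1 = 0
    · simp [h1]
    by_cases h2 : η c.2 = 0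
    · simp [h2]
    rw [logb_mul h1 h2]
    ring
  simp only [massEntropy, this, sum_add_distrib, Fintype.sum_prod_type, ← mul_sum, ← sum_mul, hκ,
    hη]
  ring

/-- The entropy of a function of `φ` is computed from the law of `φ`. -/
lemma entropy_law (p : Ω → ℝ) (φ : Ω → β) (F : β → α) :
    entropy (law p φ) F = entropy p (fun ω => F (φ ω)) := by
  classical
  have : ∀ a, law (law p φ) F a = law p (fun ω => F (φ ω)) a := by
    intro a
    have := sum_law_mul p φ fun b => if F b = a then 1 else 0
    simpa [law] using this
  simp only [entropy, this]

end EntropyLibrary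

/-! ### Products of causal kernels -/

section CausalProduct

variable {α : Type*} [Fintype α]

lemma sum_fin_snoc {n : ℕ} (F : (Fin (n + 1) → α) → ℝ) :
    ∑ y, F y = ∑ y : Fin n → α, ∑ t : α, F (Fin.snoc (α := fun _ => α) y t) := by
  rw [← (Fin.snocEquiv fun _ : Fin (n + 1) => α).sum_comp, Fintype.sum_prod_type_right]
  rfl

omit [Fintype α] in
lemma past_snoc_castSucc {n : ℕ} (y : Fin n → α) (t : α) (j : Fin n) :
    past (Fin.snoc (α := fun _ => α) y t) j.castSucc = past y j := by
  funext l
  exact Fin.snoc_castSucc (α := fun _ => α) t y ⟨l, l.2.trans j.2⟩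

omit [Fintype α] in
lemma past_snoc_last {n : ℕ} (y : Fin n → α) (t : α) :
    past (Fin.snoc (α := fun _ => α) y t) (Fin.last n) = y := by
  funext l
  exact Fin.snoc_castSucc (α := fun _ => α) t y l

omit [Fintype α] in
lemma prod_causal_snoc {n : ℕ} (k : (i : Fin (n + 1)) → (Fin (i : ℕ) → α) → α → ℝ)
    (y : Fin n → α) (t : α) :
    ∏ j, k j (past (Fin.snoc (α := fun _ => α) y t) j) (Fin.snoc (α := fun _ => α) y t j) =
      (∏ j : Fin n, k j.castSucc (past y j) (y j)) * k (Fin.last n) y t := by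
  rw [Fin.prod_univ_castSucc]
  congr 1
  · exact prod_congr rfl fun j _ => by
      rw [past_snoc_castSucc, Fin.snoc_castSucc (α := fun _ => α) t y j]
  · rw [past_snoc_last, Fin.snoc_last]

/-- The total mass of a product of causal kernels is one. -/
lemma sum_prod_causal {n : ℕ} (k : (i : Fin n) → (Fin (i : ℕ) → α) → α → ℝ)
    (hk : ∀ i h, ∑ t, k i h t = 1) : ∑ y : Fin n → α, ∏ j, k j (past y j) (y j) = 1 := by
  induction n with
  | zero => simp
  | succ n ih =>
    rw [sum_fin_snoc]
    simp only [prod_causal_snoc, ← mul_sum, hk, mul_one]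
    exact ih (fun j => k j.castSucc) fun j h => hk j.castSucc h

/-- Under a product of causal kernels, `k i` is the conditional law of the `i`-th symbol given the
symbols before it. -/
lemma sum_mul_prod_causal {n : ℕ} (k : (i : Fin n) → (Fin (i : ℕ) → α) → α → ℝ)
    (hk : ∀ i h, ∑ t, k i h t = 1) (i : Fin n) (G : (Fin (i : ℕ) → α) → α → ℝ) :
    ∑ y : Fin n → α, (∏ j, k j (past y j) (y j)) * G (past y i) (y i) =
      ∑ y : Fin n → α, (∏ j, k j (past y j) (y j)) *
        ∑ t, k i (past y i) t * G (past y i) t := by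
  induction n with
  | zero => exact i.elim0
  | succ n ih =>
    rw [sum_fin_snoc, sum_fin_snoc]
    simp only [prod_causal_snoc]
    induction i using Fin.lastCases with
    | last =>
      simp only [past_snoc_last, Fin.snoc_last, mul_assoc, ← mul_sum, ← sum_mul, hk, one_mul]
    | cast i =>
      -- The final symbol comes after time `i`; its kernel sums to one and drops out on both sides.
      have := ih (fun j => k j.castSucc) (fun j h => hk j.castSucc h) i G
      simp only [past_snoc_castSucc, Fin.snoc_castSucc]
      simp only [← sum_mul, ← mul_sum, hk, mul_one]
      exact this

end CausalProduct

/-! ### The joint law of messages and outputs -/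

section Sample

variable {q : ℕ} [NeZero q] {𝒴 : Type*} [Fintype 𝒴] {n : ℕ} {R₁₃ R₂₃ R₃₁ R₃₂ : ℝ}

/-- The message quadruples `(M₁₃, M₂₃, M₃₁, M₃₂)`. -/
abbrev Msgs (n : ℕ) (R₁₃ R₂₃ R₃₁ R₃₂ : ℝ) : Type :=
  Msg n R₁₃ × Msg n R₂₃ × Msg n R₃₁ × Msg n R₃₂

/-- The messages together with the output sequence `(Y₁ᵢ, Y₂ᵢ, Y₃ᵢ)`. -/
abbrev Sample (q : ℕ) (𝒴 : Type*) (n : ℕ) (R₁₃ R₂₃ R₃₁ R₃₂ : ℝ) : Type _ :=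
  Msgs n R₁₃ R₂₃ R₃₁ R₃₂ × (Fin n → ZMod q × ZMod q × 𝒴)

namespace Code

variable (c : Code q 𝒴 n R₁₃ R₂₃ R₃₁ R₃₂)

/-- The input of user 1 at time `i`. -/
def input₁ (i : Fin n) (ω : Sample q 𝒴 n R₁₃ R₂₃ R₃₁ R₃₂) : ZMod q :=
  c.f₁ i ω.1.1 (past (fun j => (ω.2 j).1) i)

/-- The input of user 2 at time `i`. -/
def input₂ (i : Fin n) (ω : Sample q 𝒴 n R₁₃ R₂₃ R₃₁ R₃₂) : ZMod q :=
  c.f₂ i ω.1.2.1 (past (fun j => (ω.2 j).2.1) i)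

/-- The input of user 3 at time `i`. -/
def input₃ (i : Fin n) (ω : Sample q 𝒴 n R₁₃ R₂₃ R₃₁ R₃₂) : ZMod q :=
  c.f₃ i ω.1.2.2.1 ω.1.2.2.2 (past (fun j => (ω.2 j).2.2) i)

/-- The noise symbol `Z₁` at time `i`. -/
def noise₁ (i : Fin n) (ω : Sample q 𝒴 n R₁₃ R₂₃ R₃₁ R₃₂) : ZMod q :=
  (ω.2 i).1 - c.input₁ i ω - c.input₃ i ω

/-- The noise symbol `Z₂` at time `i`. -/
def noise₂ (i : Fin n) (ω : Sample q 𝒴 n R₁₃ R₂₃ R₃₁ R₃₂) : ZMod q :=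
  (ω.2 i).2.1 - c.input₂ i ω - (ω.2 i).1 + c.input₁ i ω

end Code

/-- The joint law of the messages and the outputs. -/
noncomputable def sampleProb (W : Channel q 𝒴) (c : Code q 𝒴 n R₁₃ R₂₃ R₃₁ R₃₂)
    (ω : Sample q 𝒴 n R₁₃ R₂₃ R₃₁ R₃₂) : ℝ :=
  jointProb W c ω.1.1 ω.1.2.1 ω.1.2.2.1 ω.1.2.2.2 (fun i => (ω.2 i).1) (fun i => (ω.2 i).2.1)
    (fun i => (ω.2 i).2.2)

/-- The law of `(Y₃, Z₁, Z₂)` when the inputs are `x₁, x₂, x₃`. -/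
def Channel.kernel (W : Channel q 𝒴) (x₁ x₂ x₃ : ZMod q) (t : 𝒴 × ZMod q × ZMod q) : ℝ :=
  W.PY3 x₁ x₂ x₃ t.1 * (W.PZ1 t.2.1 * W.PZ2 t.2.2)

lemma Channel.sum_kernel (W : Channel q 𝒴) (x₁ x₂ x₃ : ZMod q) :
    ∑ t, W.kernel x₁ x₂ x₃ t = 1 := by
  simp only [Channel.kernel, Fintype.sum_prod_type, ← mul_sum, W.PZ1_mem.2, W.PZ2_mem.2, mul_one,
    (W.PY3_mem x₁ x₂ x₃).2]

lemma Channel.massEntropy_kernel (W : Channel q 𝒴) (x₁ x₂ x₃ : ZMod q) :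
    massEntropy (W.kernel x₁ x₂ x₃) =
      massEntropy (W.PY3 x₁ x₂ x₃) + (massEntropy W.PZ1 + massEntropy W.PZ2) := by
  rw [← massEntropy_mul W.PZ1_mem.2 W.PZ2_mem.2, ← massEntropy_mul (W.PY3_mem x₁ x₂ x₃).2]
  · rfl
  · simp only [Fintype.sum_prod_type, ← mul_sum, W.PZ1_mem.2, W.PZ2_mem.2, mul_one]

lemma Channel.transition_nonneg (W : Channel q 𝒴) (x₁ x₂ x₃ y₁ y₂ : ZMod q) (y₃ : 𝒴) :
    0 ≤ W.transition x₁ x₂ x₃ y₁ y₂ y₃ :=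
  mul_nonneg (mul_nonneg ((W.PY3_mem _ _ _).1 _) (W.PZ1_mem.1 _)) (W.PZ2_mem.1 _)

/-- The outputs `(Y₁, Y₂, Y₃)` correspond to `(Y₃, Z₁, Z₂)` for given inputs. -/
def outputEquiv (𝒴 : Type*) (x₁ x₂ x₃ : ZMod q) :
    ZMod q × ZMod q × 𝒴 ≃ 𝒴 × ZMod q × ZMod q where
  toFun y := (y.2.2, y.1 - x₁ - x₃, y.2.1 - x₂ - y.1 + x₁)
  invFun t := (t.2.1 + x₁ + x₃, t.2.2 + x₂ + (t.2.1 + x₁ + x₃) - x₁, t.1)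
  left_inv y := by ext <;> dsimp only <;> first | rfl | ring
  right_inv t := by ext <;> dsimp only <;> first | rfl | ring

lemma Channel.sum_transition_mul (W : Channel q 𝒴) (x₁ x₂ x₃ : ZMod q)
    (G : 𝒴 × ZMod q × ZMod q → ℝ) :
    ∑ y : ZMod q × ZMod q × 𝒴, W.transition x₁ x₂ x₃ y.1 y.2.1 y.2.2 *
        G (outputEquiv 𝒴 x₁ x₂ x₃ y) = ∑ t, W.kernel x₁ x₂ x₃ t * G t := by
  rw [← (outputEquiv 𝒴 x₁ x₂ x₃).sum_comp]
  simp [Channel.kernel, Channel.transition, outputEquiv, mul_assoc]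

variable (W : Channel q 𝒴) (c : Code q 𝒴 n R₁₃ R₂₃ R₃₁ R₃₂)

lemma sampleProb_nonneg (ω : Sample q 𝒴 n R₁₃ R₂₃ R₃₁ R₃₂) : 0 ≤ sampleProb W c ω := by
  unfold sampleProb jointProb
  exact mul_nonneg (by positivity) (prod_nonneg fun i _ => W.transition_nonneg _ _ _ _ _ _)

/-- The transition probabilities of the code with the messages `m`, as causal kernels. -/
noncomputable def stepKernel (m : Msgs n R₁₃ R₂₃ R₃₁ R₃₂) (i : Fin n)
    (h : Fin (i : ℕ) → ZMod q × ZMod q × 𝒴) (y : ZMod q × ZMod q × 𝒴) : ℝ :=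
  W.transition (c.f₁ i m.1 fun j => (h j).1) (c.f₂ i m.2.1 fun j => (h j).2.1)
    (c.f₃ i m.2.2.1 m.2.2.2 fun j => (h j).2.2) y.1 y.2.1 y.2.2

lemma sampleProb_eq (m : Msgs n R₁₃ R₂₃ R₃₁ R₃₂) (y : Fin n → ZMod q × ZMod q × 𝒴) :
    sampleProb W c (m, y) = (Fintype.card (Msgs n R₁₃ R₂₃ R₃₁ R₃₂) : ℝ)⁻¹ *
      ∏ j, stepKernel W c m j (past y j) (y j) := by
  simp only [Fintype.card_prod, Nat.cast_mul, mul_inv, ← mul_assoc]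
  rfl

lemma sum_stepKernel (m : Msgs n R₁₃ R₂₃ R₃₁ R₃₂) (i : Fin n)
    (h : Fin (i : ℕ) → ZMod q × ZMod q × 𝒴) : ∑ y, stepKernel W c m i h y = 1 := by
  have := W.sum_transition_mul (c.f₁ i m.1 fun j => (h j).1) (c.f₂ i m.2.1 fun j => (h j).2.1)
    (c.f₃ i m.2.2.1 m.2.2.2 fun j => (h j).2.2) fun _ => 1
  simp only [mul_one, W.sum_kernel] at this
  exact this

/-- For fixed messages the output law is a product of causal kernels, of total mass one, so only the
uniform message weight survives. -/
lemma law_sampleProb_messages (m : Msgs n R₁₃ R₂₃ R₃₁ R₃₂) :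
    law (sampleProb W c) Prod.fst m = (Fintype.card (Msgs n R₁₃ R₂₃ R₃₁ R₃₂) : ℝ)⁻¹ := by
  classical
  have : ∀ m' : Msgs n R₁₃ R₂₃ R₃₁ R₃₂, (∑ y, if m' = m then sampleProb W c (m', y) else 0) =
      if m' = m then (Fintype.card (Msgs n R₁₃ R₂₃ R₃₁ R₃₂) : ℝ)⁻¹ else 0 := by
    intro m'
    split_ifs with h
    · simp only [sampleProb_eq, ← mul_sum]
      rw [sum_prod_causal _ (sum_stepKernel W c m'), mul_one]
    · simp
  have h2 : law (sampleProb W c) Prod.fst m = ∑ m', ∑ y,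
      if m' = m then sampleProb W c (m', y) else 0 := by
    rw [law, Fintype.sum_prod_type]
    congr!
  rw [h2]
  simp [this]

/-- Given the messages and the past outputs, `(Y₃, Z₁, Z₂)` is distributed according to the
channel kernel. -/
lemma sum_sampleProb_mul (i : Fin n)
    (G : Msgs n R₁₃ R₂₃ R₃₁ R₃₂ × (Fin (i : ℕ) → ZMod q × ZMod q × 𝒴) →
      𝒴 × ZMod q × ZMod q → ℝ) :
    ∑ ω, sampleProb W c ω *
        G (ω.1, past ω.2 i) ((ω.2 i).2.2, c.noise₁ i ω, c.noise₂ i ω) =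
      ∑ ω, sampleProb W c ω *
        ∑ t, W.kernel (c.input₁ i ω) (c.input₂ i ω) (c.input₃ i ω) t *
          G (ω.1, past ω.2 i) t := by
  refine (Fintype.sum_prod_type _).trans (Eq.trans ?_ (Fintype.sum_prod_type _).symm)
  refine sum_congr rfl fun m _ => ?_
  simp only [sampleProb_eq, mul_assoc, ← mul_sum]
  congr 1
  -- The messages and the past fix the inputs at time `i`, so the outputs can be exchanged
  -- bijectively for (Y₃, Z₁, Z₂).
  refine (sum_mul_prod_causal (stepKernel W c m) (sum_stepKernel W c m) i fun h y =>
    G (m, h) (outputEquiv 𝒴 (c.f₁ i m.1 fun j => (h j).1) (c.f₂ i m.2.1 fun j => (h j).2.1)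
      (c.f₃ i m.2.2.1 m.2.2.2 fun j => (h j).2.2) y)).trans ?_
  refine sum_congr rfl fun y _ => ?_
  congr 1
  exact W.sum_transition_mul _ _ _ fun t => G (m, past y i) t

open Classical in
lemma errorProb_eq : errorProb W c = ∑ ω : Sample q 𝒴 n R₁₃ R₂₃ R₃₁ R₃₂,
    if (c.g₃ ω.1.2.2.1 ω.1.2.2.2 (fun i => (ω.2 i).2.2)).1 ≠ ω.1.1 ∨
        (c.g₃ ω.1.2.2.1 ω.1.2.2.2 (fun i => (ω.2 i).2.2)).2 ≠ ω.1.2.1 ∨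
        c.g₁ ω.1.1 (fun i => (ω.2 i).1) ≠ ω.1.2.2.1 ∨
        c.g₂ ω.1.2.1 (fun i => (ω.2 i).2.1) ≠ ω.1.2.2.2
    then sampleProb W c ω else 0 := by
  simp only [errorProb]
  rw [Fintype.sum_prod_type, Fintype.sum_prod_type]
  refine sum_congr rfl fun m₁ _ => ?_
  rw [Fintype.sum_prod_type]
  refine sum_congr rfl fun m₂ _ => ?_
  rw [Fintype.sum_prod_type]
  refine sum_congr rfl fun m₃ _ => sum_congr rfl fun m₄ _ => ?_
  let e : (Fin n → ZMod q × ZMod q × 𝒴) ≃ (Fin n → ZMod q) × (Fin n → ZMod q) × (Fin n → 𝒴) :=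
    { toFun := fun y => (fun i => (y i).1, fun i => (y i).2.1, fun i => (y i).2.2)
      invFun := fun z i => (z.1 i, z.2.1 i, z.2.2 i)
      left_inv := fun _ => rfl
      right_inv := fun _ => rfl }
  rw [← e.symm.sum_comp, Fintype.sum_prod_type]
  refine sum_congr rfl fun y₁ _ => ?_
  rw [Fintype.sum_prod_type]
  refine sum_congr rfl fun y₂ _ => sum_congr rfl fun y₃ _ => ?_
  congr!

end Sample

/-! ### Chain rule and Fano along a sequence -/

section ChainRule

variable {Ω α β γ τ : Type*} [Fintype Ω] [Fintype α] [Fintype β] [Fintype γ] [Fintype τ]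
  {p : Ω → ℝ} {n : ℕ}

/-- The symbols of `y` before time `k`, padded to length `n`. -/
def prefixOf (y : Fin n → τ) (k : ℕ) : Fin n → Option τ :=
  fun j => if (j : ℕ) < k then some (y j) else none

omit [Fintype τ] in
lemma prefixOf_eq_iff {y z : Fin n → τ} {k : ℕ} :
    prefixOf y k = prefixOf z k ↔ ∀ j : Fin n, (j : ℕ) < k → y j = z j := by
  simp only [prefixOf, funext_iff]
  refine forall_congr' fun j => ?_
  by_cases h : (j : ℕ) < k <;> simp [h]

omit [Fintype τ] in
lemma past_eq_iff {y z : Fin n → τ} {i : Fin n} :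
    past y i = past z i ↔ ∀ j : Fin n, (j : ℕ) < i → y j = z j := by
  simp only [past, funext_iff]
  exact ⟨fun h j hj => h ⟨j, hj⟩, fun h j => h _ j.2⟩

/-- Telescoping of the entropies of `B` with the first `k` symbols. Padding gives all prefixes one
type, so that `k` can run over the natural numbers. -/
lemma condEntropy_seq (Y : Fin n → Ω → τ) (B : Ω → β) :
    condEntropy p (fun ω j => Y j ω) B =
      ∑ i : Fin n, condEntropy p (Y i) (fun ω => (B ω, prefixOf (fun j => Y j ω) i)) := by
  set F : ℕ → ℝ := fun k => entropy p (fun ω => (B ω, prefixOf (fun j => Y j ω) k)) with hF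
  have hstep : ∀ i : Fin n, condEntropy p (Y i) (fun ω => (B ω, prefixOf (fun j => Y j ω) i)) =
      F (i + 1) - F i := by
    intro i
    rw [condEntropy, hF]
    congr 1
    refine entropy_congr fun ω ω' => ?_
    simp only [Prod.mk.injEq, prefixOf_eq_iff]
    constructor
    · rintro ⟨h1, h2, h3⟩
      refine ⟨h2, fun j hj => ?_⟩
      rcases Nat.lt_succ_iff_lt_or_eq.1 hj with h | h
      · exact h3 j h
      · rw [Fin.ext h]; exact h1
    · rintro ⟨h2, h3⟩
      exact ⟨h3 i (Nat.lt_succ_self _), h2, fun j hj => h3 j (hj.trans (Nat.lt_succ_self _))⟩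
  rw [sum_congr rfl fun i _ => hstep i, Fin.sum_univ_eq_sum_range (fun k => F (k + 1) - F k) n,
    sum_range_sub, condEntropy]
  congr 1
  · refine entropy_congr fun ω ω' => ?_
    simp only [Prod.mk.injEq, prefixOf_eq_iff, Fin.is_lt, forall_true_left]
    rw [funext_iff, and_comm]
  · refine entropy_congr fun ω ω' => ?_
    simp [prefixOf_eq_iff]

/-- A message that is decoded with small error probability from an observed sequence and side
information has entropy at most the information accumulated step by step. -/
lemma condEntropy_le_sum (hp : ∀ ω, 0 ≤ p ω) (hp1 : ∑ ω, p ω = 1) (Y : Fin n → Ω → τ) (B : Ω → β)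
    (C : Ω → γ) [DecidableEq γ] (g : (Fin n → τ) → β → γ) {E : ℝ} (a b : Fin n → ℝ)
    (hE : ∑ ω, (if C ω ≠ g (fun j => Y j ω) (B ω) then p ω else 0) ≤ E)
    (ha : ∀ i, condEntropy p (Y i) (fun ω => (B ω, prefixOf (fun j => Y j ω) i)) ≤ a i)
    (hb : ∀ i, b i ≤ condEntropy p (Y i) (fun ω => ((C ω, B ω), prefixOf (fun j => Y j ω) i))) :
    condEntropy p C B ≤ 1 + E * logb 2 (Fintype.card γ) + ∑ i, (a i - b i) := by
  have h1 := condMutualInfo_symm (p := p) C (fun ω j => Y j ω) B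
  rw [condMutualInfo, condEntropy_seq, condEntropy_seq, ← sum_sub_distrib] at h1
  have h2 := condEntropy_le_fano hp hp1 C (fun ω => (fun j => Y j ω, B ω)) (fun x => g x.1 x.2) hE
  have h3 := sum_le_sum fun i (_ : i ∈ univ) => sub_le_sub (ha i) (hb i)
  linarith

end ChainRule

/-! ### Entropy bounds for a code with feedback -/

section CodeEntropy

variable {q : ℕ} [NeZero q] {𝒴 : Type*} [Fintype 𝒴] {n : ℕ} {R₁₃ R₂₃ R₃₁ R₃₂ : ℝ}

namespace Code

variable (c : Code q 𝒴 n R₁₃ R₂₃ R₃₁ R₃₂)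

/-- The output of the third user and the noise symbols at time `i`. -/
def obs (i : Fin n) (ω : Sample q 𝒴 n R₁₃ R₂₃ R₃₁ R₃₂) : 𝒴 × ZMod q × ZMod q :=
  ((ω.2 i).2.2, c.noise₁ i ω, c.noise₂ i ω)

/-- What user 1 receives in addition to its own input. -/
def recv₁ (i : Fin n) (ω : Sample q 𝒴 n R₁₃ R₂₃ R₃₁ R₃₂) : ZMod q :=
  c.input₃ i ω + c.noise₁ i ω

/-- What user 2 receives in addition to its own input. -/
def recv₂ (i : Fin n) (ω : Sample q 𝒴 n R₁₃ R₂₃ R₃₁ R₃₂) : ZMod q :=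
  c.input₃ i ω + c.noise₁ i ω + c.noise₂ i ω

variable {c} {i : Fin n} {ω ω' : Sample q 𝒴 n R₁₃ R₂₃ R₃₁ R₃₂}

omit [NeZero q] [Fintype 𝒴]

lemma output₁_eq : (ω.2 i).1 = c.input₁ i ω + c.recv₁ i ω := by
  simp only [recv₁, noise₁]; ring

lemma output₂_eq : (ω.2 i).2.1 = c.input₂ i ω + c.recv₂ i ω := by
  simp only [recv₂, noise₁, noise₂]; ring

lemma input₁_congr (hm : ω.1.1 = ω'.1.1)
    (h : ∀ j : Fin n, (j : ℕ) < i → (ω.2 j).1 = (ω'.2 j).1) : c.input₁ i ω = c.input₁ i ω' := by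
  rw [input₁, input₁, hm, past_eq_iff.2 h]

lemma input₂_congr (hm : ω.1.2.1 = ω'.1.2.1)
    (h : ∀ j : Fin n, (j : ℕ) < i → (ω.2 j).2.1 = (ω'.2 j).2.1) :
    c.input₂ i ω = c.input₂ i ω' := by
  rw [input₂, input₂, hm, past_eq_iff.2 h]

lemma input₃_congr (hm : ω.1.2.2 = ω'.1.2.2)
    (h : ∀ j : Fin n, (j : ℕ) < i → (ω.2 j).2.2 = (ω'.2 j).2.2) :
    c.input₃ i ω = c.input₃ i ω' := by
  rw [input₃, input₃, hm, past_eq_iff.2 h]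

lemma input₃_congr_obs (hm : ω.1.2.2 = ω'.1.2.2)
    (h : ∀ j : Fin n, (j : ℕ) < i → c.obs j ω = c.obs j ω') : c.input₃ i ω = c.input₃ i ω' :=
  input₃_congr hm fun j hj => congrArg Prod.fst (h j hj)

/-- Induction on time. M₃₁, M₃₂ and the past of Y₃ give the earlier X₃; with the earlier X₁ from the
induction and the noise, this gives the earlier Y₁, which together with M₁₃ is all that encoder 1
uses. M₂₃ plays no role. -/
lemma input₁_congr_obs (hm : ω.1.2.2 = ω'.1.2.2) (hm₁ : ω.1.1 = ω'.1.1)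
    (h : ∀ j : Fin n, (j : ℕ) < i → c.obs j ω = c.obs j ω') : c.input₁ i ω = c.input₁ i ω' := by
  induction hk : (i : ℕ) using Nat.strong_induction_on generalizing i with
  | _ k ih =>
    refine input₁_congr hm₁ fun j hj => ?_
    have h' : ∀ l : Fin n, (l : ℕ) < j → c.obs l ω = c.obs l ω' := fun l hl => h l (hl.trans hj)
    have h3 : c.noise₁ j ω = c.noise₁ j ω' := congrArg (fun t => t.2.1) (h j hj)
    rw [output₁_eq (c := c), output₁_eq (c := c), recv₁, recv₁, ih j (hk ▸ hj) h' rfl,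
      input₃_congr_obs hm h', h3]

/-- The same recursion for user 2. Since Y₂ = X₂ + X₃ + Z₁ + Z₂ does not involve X₁, M₁₃ is not
required, but both noises are. -/
lemma input₂_congr_obs (hm : ω.1.2.2 = ω'.1.2.2) (hm₂ : ω.1.2.1 = ω'.1.2.1)
    (h : ∀ j : Fin n, (j : ℕ) < i → c.obs j ω = c.obs j ω') : c.input₂ i ω = c.input₂ i ω' := by
  induction hk : (i : ℕ) using Nat.strong_induction_on generalizing i with
  | _ k ih =>
    refine input₂_congr hm₂ fun j hj => ?_
    have h' : ∀ l : Fin n, (l : ℕ) < j → c.obs l ω = c.obs l ω' := fun l hl => h l (hl.trans hj)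
    have h3 : c.noise₁ j ω = c.noise₁ j ω' := congrArg (fun t => t.2.1) (h j hj)
    have h4 : c.noise₂ j ω = c.noise₂ j ω' := congrArg (fun t => t.2.2) (h j hj)
    rw [output₂_eq (c := c), output₂_eq (c := c), recv₂, recv₂, ih j (hk ▸ hj) h' rfl,
      input₃_congr_obs hm h', h3, h4]

/-- Given all messages, the past outputs and the past observations determine each other. -/
lemma past_eq_iff_obs (hm : ω.1 = ω'.1) :
    past ω.2 i = past ω'.2 i ↔ ∀ j : Fin n, (j : ℕ) < i → c.obs j ω = c.obs j ω' := by
  rw [past_eq_iff]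
  constructor
  · intro h j hj
    have h' : ∀ l : Fin n, (l : ℕ) < j → ω.2 l = ω'.2 l := fun l hl => h l (hl.trans hj)
    have h1 : c.input₁ j ω = c.input₁ j ω' := input₁_congr (by rw [hm]) fun l hl => by rw [h' l hl]
    have h2 : c.input₂ j ω = c.input₂ j ω' := input₂_congr (by rw [hm]) fun l hl => by rw [h' l hl]
    have h3 : c.input₃ j ω = c.input₃ j ω' := input₃_congr (by rw [hm]) fun l hl => by rw [h' l hl]
    simp only [obs, noise₁, noise₂, h1, h2, h3, h j hj]
  · intro h j hj
    have h' : ∀ l : Fin n, (l : ℕ) < j → c.obs l ω = c.obs l ω' := fun l hl => h l (hl.trans hj)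
    have h0 := h j hj
    simp only [obs, Prod.mk.injEq] at h0
    have h1 := input₁_congr_obs (by rw [hm]) (by rw [hm]) h'
    have h2 := input₂_congr_obs (by rw [hm]) (by rw [hm]) h'
    have h3 := input₃_congr_obs (by rw [hm]) h'
    refine Prod.ext ?_ (Prod.ext ?_ h0.1)
    · rw [output₁_eq (c := c), output₁_eq (c := c), recv₁, recv₁, h1, h3, h0.2.1]
    · rw [output₂_eq (c := c), output₂_eq (c := c), recv₂, recv₂, h2, h3, h0.2.1, h0.2.2]

end Code

variable (W : Channel q 𝒴) (c : Code q 𝒴 n R₁₃ R₂₃ R₃₁ R₃₂)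

/-- The average conditional entropy of `Y₃` given the inputs at time `i`. -/
noncomputable def outputEntropy (i : Fin n) : ℝ :=
  ∑ ω, sampleProb W c ω *
    massEntropy (W.PY3 (c.input₁ i ω) (c.input₂ i ω) (c.input₃ i ω))

/-- The channel kernel is a product of the law of Y₃ and the two noise laws, so its entropy splits.
-/
lemma condEntropy_obs (hp1 : ∑ ω, sampleProb W c ω = 1) (i : Fin n) :
    condEntropy (sampleProb W c) (c.obs i) (fun ω => (ω.1, past ω.2 i)) =
      outputEntropy W c i + (massEntropy W.PZ1 + massEntropy W.PZ2) := by
  rw [condEntropy_eq_of_condLaw (sampleProb_nonneg W c) (fun ω => (ω.1, past ω.2 i)) (c.obs i)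
    (fun ω => W.kernel (c.input₁ i ω) (c.input₂ i ω) (c.input₃ i ω)) ?_ (sum_sampleProb_mul W c i)]
  · simp only [Channel.massEntropy_kernel, mul_add, sum_add_distrib, outputEntropy, ← sum_mul, hp1,
      one_mul]
  · exact fun ω ω' h => congrArg (fun a : Msgs n R₁₃ R₂₃ R₃₁ R₃₂ ×
      (Fin (i : ℕ) → ZMod q × ZMod q × 𝒴) => W.kernel (c.f₁ i a.1.1 fun j => (a.2 j).1)
        (c.f₂ i a.1.2.1 fun j => (a.2 j).2.1) (c.f₃ i a.1.2.2.1 a.1.2.2.2 fun j => (a.2 j).2.2)) h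

lemma Channel.sum_kernel_mul_noise (x₁ x₂ x₃ : ZMod q) (G : ZMod q × ZMod q → ℝ) :
    ∑ t, W.kernel x₁ x₂ x₃ t * G t.2 = ∑ z : ZMod q × ZMod q, W.PZ1 z.1 * W.PZ2 z.2 * G z := by
  rw [Fintype.sum_prod_type]
  simp only [Channel.kernel, mul_assoc, ← mul_sum]
  rw [← sum_mul, (W.PY3_mem x₁ x₂ x₃).2, one_mul]

/-- The noise is independent of the messages and the past. -/
lemma condEntropy_noise (hp1 : ∑ ω, sampleProb W c ω = 1) (i : Fin n) :
    condEntropy (sampleProb W c) (fun ω => (c.noise₁ i ω, c.noise₂ i ω))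
      (fun ω => (ω.1, past ω.2 i)) = massEntropy W.PZ1 + massEntropy W.PZ2 := by
  rw [condEntropy_eq_of_condLaw (sampleProb_nonneg W c) (fun ω => (ω.1, past ω.2 i)) _
    (fun ω z => W.PZ1 z.1 * W.PZ2 z.2) (fun _ _ _ => rfl)]
  · rw [massEntropy_mul W.PZ1_mem.2 W.PZ2_mem.2, ← sum_mul, hp1, one_mul]
  · intro G
    simpa only [Channel.sum_kernel_mul_noise] using sum_sampleProb_mul W c i fun a t => G a t.2

lemma entropy_noise (hp1 : ∑ ω, sampleProb W c ω = 1) (i : Fin n) :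
    entropy (sampleProb W c) (fun ω => (c.noise₁ i ω, c.noise₂ i ω)) =
      massEntropy W.PZ1 + massEntropy W.PZ2 := by
  rw [← condEntropy_const hp1 _ (Z := fun _ => ()) (by simp),
    condEntropy_eq_of_condLaw (sampleProb_nonneg W c) (fun _ => ()) _
    (fun ω z => W.PZ1 z.1 * W.PZ2 z.2) (fun _ _ _ => rfl)]
  · rw [massEntropy_mul W.PZ1_mem.2 W.PZ2_mem.2, ← sum_mul, hp1, one_mul]
  · intro G
    simpa only [Channel.sum_kernel_mul_noise] using
      sum_sampleProb_mul W c i fun _ t => G () t.2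

lemma entropy_noise₂ (hp1 : ∑ ω, sampleProb W c ω = 1) (i : Fin n) :
    entropy (sampleProb W c) (c.noise₂ i) = massEntropy W.PZ2 := by
  rw [← condEntropy_const hp1 _ (Z := fun _ => ()) (by simp),
    condEntropy_eq_of_condLaw (sampleProb_nonneg W c) (fun _ => ()) _
    (fun ω => W.PZ2) (fun _ _ _ => rfl)]
  · rw [← sum_mul, hp1, one_mul]
  · intro G
    have := sum_sampleProb_mul W c i fun _ t => G () t.2.2
    have h2 : ∑ z : ZMod q × ZMod q, W.PZ1 z.1 * W.PZ2 z.2 * G () z.2 =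
        ∑ z, W.PZ2 z * G () z := by
      rw [Fintype.sum_prod_type]
      simp only [mul_assoc, ← mul_sum, ← sum_mul, W.PZ1_mem.2, one_mul]
    simpa only [Channel.sum_kernel_mul_noise W _ _ _ fun z => G () z.2, h2] using this

variable {β γ δ : Type*} [Fintype β] [Fintype γ] [Fintype δ]

/-- Uniformity makes H(D,C,B) the logarithm of the number of message tuples, and H(D|C,B) and H(B)
are at most the logarithms of their alphabet sizes; subtraction leaves the bound. Independence of
the messages enters only through this count. -/
lemma logb_card_le_condEntropy (hp1 : ∑ ω, sampleProb W c ω = 1)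
    (B : Msgs n R₁₃ R₂₃ R₃₁ R₃₂ → β) (C : Msgs n R₁₃ R₂₃ R₃₁ R₃₂ → γ)
    (D : Msgs n R₁₃ R₂₃ R₃₁ R₃₂ → δ) (h : ∀ m m', D m = D m' → C m = C m' → B m = B m' → m = m')
    (hcard : Fintype.card (Msgs n R₁₃ R₂₃ R₃₁ R₃₂) =
      Fintype.card δ * Fintype.card γ * Fintype.card β) :
    logb 2 (Fintype.card γ) ≤
      condEntropy (sampleProb W c) (fun ω => C ω.1) (fun ω => B ω.1) := by
  have hp := sampleProb_nonneg W c
  have h0 : (Fintype.card (Msgs n R₁₃ R₂₃ R₃₁ R₃₂) : ℝ) ≠ 0 := by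
    intro h0
    have : IsEmpty (Msgs n R₁₃ R₂₃ R₃₁ R₃₂) := Fintype.card_eq_zero_iff.1 (by exact_mod_cast h0)
    simp at hp1
  have h1 : entropy (sampleProb W c) Prod.fst =
      logb 2 (Fintype.card (Msgs n R₁₃ R₂₃ R₃₁ R₃₂)) := by
    rw [entropy_eq]
    simp only [law_sampleProb_messages, ← sum_mul, hp1, one_mul, logb_inv, neg_neg]
  have h2 : entropy (sampleProb W c) (fun ω => (D ω.1, C ω.1, B ω.1)) =
      entropy (sampleProb W c) Prod.fst :=
    entropy_congr (by
      simp only [Prod.mk.injEq]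
      exact fun ω ω' => ⟨fun a => h _ _ a.1 a.2.1 a.2.2, fun a => by rw [a]; simp⟩)
  have h3 := entropy_le_logb_card hp hp1 fun ω => B ω.1
  have h4 := (condEntropy_le_entropy hp hp1 (fun ω => D ω.1) (fun ω => (C ω.1, B ω.1))).trans
    (entropy_le_logb_card hp hp1 _)
  rw [condEntropy, h2, h1, hcard] at h4
  rw [hcard] at h0
  push_cast at h0 h4
  rw [logb_mul (left_ne_zero_of_mul h0) (right_ne_zero_of_mul h0),
    logb_mul (left_ne_zero_of_mul (left_ne_zero_of_mul h0))
      (right_ne_zero_of_mul (left_ne_zero_of_mul h0))] at h4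
  rw [condEntropy]
  linarith

lemma sum_ite_le_errorProb (P : Sample q 𝒴 n R₁₃ R₂₃ R₃₁ R₃₂ → Prop)
    [DecidablePred P]
    (h : ∀ ω, P ω → (c.g₃ ω.1.2.2.1 ω.1.2.2.2 (fun i => (ω.2 i).2.2)).1 ≠ ω.1.1 ∨
        (c.g₃ ω.1.2.2.1 ω.1.2.2.2 (fun i => (ω.2 i).2.2)).2 ≠ ω.1.2.1 ∨
        c.g₁ ω.1.1 (fun i => (ω.2 i).1) ≠ ω.1.2.2.1 ∨
        c.g₂ ω.1.2.1 (fun i => (ω.2 i).2.1) ≠ ω.1.2.2.2) :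
    ∑ ω, (if P ω then sampleProb W c ω else 0) ≤ errorProb W c := by
  classical
  rw [errorProb_eq]
  refine sum_le_sum fun ω _ => ?_
  by_cases hP : P ω
  · simp only [hP, h ω hP, if_true, le_refl]
  · simp only [hP, if_false]
    split_ifs
    · exact sampleProb_nonneg W c ω
    · exact le_rfl

/-- The converse for the multiple-access direction: `C` is the message (or pair of messages) to be
decoded, `B` consists of the other messages, and `X` are inputs known to the decoder. -/
lemma mac_converse (hp1 : ∑ ω, sampleProb W c ω = 1)
    (B : Msgs n R₁₃ R₂₃ R₃₁ R₃₂ → β) (C : Msgs n R₁₃ R₂₃ R₃₁ R₃₂ → γ)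
    (h : ∀ m m', C m = C m' → B m = B m' → m = m')
    (hcard : Fintype.card (Msgs n R₁₃ R₂₃ R₃₁ R₃₂) = Fintype.card γ * Fintype.card β)
    (X : Fin n → Sample q 𝒴 n R₁₃ R₂₃ R₃₁ R₃₂ → δ)
    (hX : ∀ (i : Fin n) ω ω', B ω.1 = B ω'.1 → (∀ j : Fin n, (j : ℕ) < i → c.obs j ω = c.obs j ω') →
      X i ω = X i ω')
    (g : (Fin n → 𝒴) → β → γ)
    (hg : ∀ ω : Sample q 𝒴 n R₁₃ R₂₃ R₃₁ R₃₂, C ω.1 ≠ g (fun j => (ω.2 j).2.2) (B ω.1) →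
      (c.g₃ ω.1.2.2.1 ω.1.2.2.2 (fun i => (ω.2 i).2.2)).1 ≠ ω.1.1 ∨
        (c.g₃ ω.1.2.2.1 ω.1.2.2.2 (fun i => (ω.2 i).2.2)).2 ≠ ω.1.2.1) :
    logb 2 (Fintype.card γ) ≤ 1 + errorProb W c * logb 2 (Fintype.card γ) +
      ∑ i, (condEntropy (sampleProb W c) (fun ω => (ω.2 i).2.2) (X i) - outputEntropy W c i) := by
  classical
  have hp := sampleProb_nonneg W c
  refine (logb_card_le_condEntropy W c hp1 B C (fun _ => ()) (fun m m' _ => h m m')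
    (by simpa using hcard)).trans ?_
  -- The decoder observes the noise besides Y₃. Both bounds carry the same noise entropy, which
  -- cancels in the difference.
  refine (condEntropy_le_sum hp hp1 c.obs (fun ω => B ω.1) (fun ω => C ω.1)
    (fun y b => g (fun j => (y j).1) b)
    (fun i => condEntropy (sampleProb W c) (fun ω => (ω.2 i).2.2) (X i) +
      (massEntropy W.PZ1 + massEntropy W.PZ2))
    (fun i => outputEntropy W c i + (massEntropy W.PZ1 + massEntropy W.PZ2))
    (E := errorProb W c) ?_ ?_ ?_).trans_eq ?_
  · exact sum_ite_le_errorProb W c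
      (fun ω => C ω.1 ≠ g (fun j => (ω.2 j).2.2) (B ω.1))
      (fun ω hω => (hg ω hω).elim Or.inl fun h => Or.inr (Or.inl h))
  · intro i
    have hpair := condEntropy_pair (p := sampleProb W c) (fun ω => (ω.2 i).2.2)
      (fun ω => (c.noise₁ i ω, c.noise₂ i ω))
      (fun ω => (B ω.1, prefixOf (fun j => c.obs j ω) i))
    refine hpair.trans_le (add_le_add (condEntropy_anti hp _ ?_) ?_)
    · simp only [Prod.mk.injEq, prefixOf_eq_iff]
      exact fun ω ω' a => hX i ω ω' a.1 a.2
    · rw [← entropy_noise W c hp1 i]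
      exact condEntropy_le_entropy hp hp1 _ _
  · intro i
    refine le_of_eq ?_
    -- `C` and `B` together are all the messages; given these, past observations and past outputs
    -- are equivalent.
    rw [← condEntropy_obs W c hp1 i]
    refine condEntropy_congr ?_ (by simp)
    intro ω ω'
    simp only [Prod.mk.injEq, prefixOf_eq_iff]
    have h' : (C ω.1 = C ω'.1 ∧ B ω.1 = B ω'.1) ↔ ω.1 = ω'.1 :=
      ⟨fun a => h _ _ a.1 a.2, fun a => by rw [a]; simp⟩
    rw [h']
    exact and_congr_right fun hm => Code.past_eq_iff_obs hm
  · simp only [add_sub_add_right_eq_sub]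

/-- The auxiliary random variable at time `i`: all messages except `M₃₁`, and the past outputs of
users 1 and 2. -/
def auxVar (i : Fin n) (ω : Sample q 𝒴 n R₁₃ R₂₃ R₃₁ R₃₂) :
    (Msg n R₁₃ × Msg n R₂₃ × Msg n R₃₂) × (Fin n → Option (ZMod q × ZMod q)) :=
  ((ω.1.1, ω.1.2.1, ω.1.2.2.2), prefixOf (fun j => ((ω.2 j).1, (ω.2 j).2.1)) i)

omit [NeZero q] [Fintype 𝒴] in
lemma inputs_congr_of_auxVar {i : Fin n} {ω ω' : Sample q 𝒴 n R₁₃ R₂₃ R₃₁ R₃₂}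
    (h : auxVar i ω = auxVar i ω') :
    c.input₁ i ω = c.input₁ i ω' ∧ c.input₂ i ω = c.input₂ i ω' := by
  simp only [auxVar, Prod.mk.injEq, prefixOf_eq_iff] at h
  exact ⟨Code.input₁_congr h.1.1 fun j hj => (h.2 j hj).1,
    Code.input₂_congr h.1.2.1 fun j hj => (h.2 j hj).2⟩

/-- The converse for the message `M₃₁`. -/
lemma broadcast_converse₁ (hp1 : ∑ ω, sampleProb W c ω = 1) :
    logb 2 (Fintype.card (Msg n R₃₁)) ≤ 1 + errorProb W c * logb 2 (Fintype.card (Msg n R₃₁)) +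
      ∑ i, (condEntropy (sampleProb W c) (c.recv₁ i) (auxVar i) - massEntropy W.PZ1) := by
  classical
  have hp := sampleProb_nonneg W c
  refine (logb_card_le_condEntropy W c hp1 (fun m => (m.1, m.2.1, m.2.2.2)) (fun m => m.2.2.1)
    (fun _ => ()) (by simp only [Prod.ext_iff]; tauto)
    (by simp only [Fintype.card_prod, Fintype.card_unit]; ring)).trans ?_
  -- User 1 is also given Y₂. The additional entropy is at most that of Z₂, which the lower bound
  -- contains as well.
  refine (condEntropy_le_sum hp hp1 (fun i ω => ((ω.2 i).1, (ω.2 i).2.1))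
    (fun ω => (ω.1.1, ω.1.2.1, ω.1.2.2.2)) (fun ω => ω.1.2.2.1)
    (fun y b => c.g₁ b.1 (fun j => (y j).1))
    (fun i => condEntropy (sampleProb W c) (c.recv₁ i) (auxVar i) + massEntropy W.PZ2)
    (fun i => massEntropy W.PZ1 + massEntropy W.PZ2)
    (E := errorProb W c) ?_ ?_ ?_).trans_eq ?_
  · exact sum_ite_le_errorProb W c
      (fun ω => ω.1.2.2.1 ≠ c.g₁ ω.1.1 (fun j => (ω.2 j).1))
      (fun ω hω => Or.inr (Or.inr (Or.inl hω.symm)))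
  · intro i
    change condEntropy _ _ (auxVar i) ≤ _
    have h1 : condEntropy (sampleProb W c) (fun ω => ((ω.2 i).1, (ω.2 i).2.1)) (auxVar i) =
        condEntropy (sampleProb W c) (fun ω => (c.recv₁ i ω, c.noise₂ i ω)) (auxVar i) := by
      refine condEntropy_congr (by simp) fun ω ω' h => ?_
      obtain ⟨e1, e2⟩ := inputs_congr_of_auxVar c h
      simp only [Prod.mk.injEq]
      rw [Code.output₁_eq (c := c), Code.output₁_eq (c := c), Code.output₂_eq (c := c),
        Code.output₂_eq (c := c), e1, e2, add_right_inj, add_right_inj]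
      have hr : ∀ ω, c.recv₂ i ω = c.recv₁ i ω + c.noise₂ i ω := fun _ => rfl
      rw [hr, hr]
      refine and_congr_right fun h => ?_
      rw [h, add_right_inj]
    rw [h1, condEntropy_pair]
    refine add_le_add le_rfl ?_
    rw [← entropy_noise₂ W c hp1 i]
    exact condEntropy_le_entropy hp hp1 _ _
  · intro i
    have hcongr : condEntropy (sampleProb W c) (fun ω => ((ω.2 i).1, (ω.2 i).2.1))
        (fun ω => (ω.1, past ω.2 i)) = massEntropy W.PZ1 + massEntropy W.PZ2 := by
      rw [← condEntropy_noise W c hp1 i]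
      refine condEntropy_congr (by simp) fun ω ω' h => ?_
      simp only [Prod.mk.injEq, past_eq_iff] at h
      have e1 : c.input₁ i ω = c.input₁ i ω' :=
        Code.input₁_congr (by rw [h.1]) fun j hj => by rw [h.2 j hj]
      have e2 : c.input₂ i ω = c.input₂ i ω' :=
        Code.input₂_congr (by rw [h.1]) fun j hj => by rw [h.2 j hj]
      have e3 : c.input₃ i ω = c.input₃ i ω' :=
        Code.input₃_congr (by rw [h.1]) fun j hj => by rw [h.2 j hj]
      simp only [Prod.mk.injEq]
      rw [Code.output₁_eq (c := c), Code.output₁_eq (c := c), Code.output₂_eq (c := c),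
        Code.output₂_eq (c := c), e1, e2, add_right_inj, add_right_inj]
      simp only [Code.recv₁, Code.recv₂, e3, add_right_inj]
      refine and_congr_right fun h => ?_
      rw [h, add_right_inj]
    rw [← hcongr]
    -- Adding the past of Y₃ to the condition fixes X₃ too and leaves only the noise random.
    refine condEntropy_anti hp _ fun ω ω' h => ?_
    simp only [Prod.mk.injEq, past_eq_iff, prefixOf_eq_iff] at h ⊢
    rw [h.1]
    exact ⟨⟨rfl, rfl, rfl, rfl⟩, fun j hj => by rw [h.2 j hj]; simp⟩
  · simp only [add_sub_add_right_eq_sub]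

/-- The converse for the message `M₃₂`. -/
lemma broadcast_converse₂ (hp1 : ∑ ω, sampleProb W c ω = 1) :
    logb 2 (Fintype.card (Msg n R₃₂)) ≤ 1 + errorProb W c * logb 2 (Fintype.card (Msg n R₃₂)) +
      ∑ i, (entropy (sampleProb W c) (c.recv₂ i) -
        condEntropy (sampleProb W c) (c.recv₂ i) (auxVar i)) := by
  classical
  have hp := sampleProb_nonneg W c
  refine (logb_card_le_condEntropy W c hp1 (fun m => (m.1, m.2.1)) (fun m => m.2.2.2)
    (fun m => m.2.2.1) (by simp only [Prod.ext_iff]; tauto)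
    (by simp only [Fintype.card_prod]; ring)).trans ?_
  refine condEntropy_le_sum hp hp1 (fun i ω => (ω.2 i).2.1)
    (fun ω => (ω.1.1, ω.1.2.1)) (fun ω => ω.1.2.2.2)
    (fun y b => c.g₂ b.2 y)
    (fun i => entropy (sampleProb W c) (c.recv₂ i))
    (fun i => condEntropy (sampleProb W c) (c.recv₂ i) (auxVar i))
    (E := errorProb W c) ?_ ?_ ?_
  · exact sum_ite_le_errorProb W c
      (fun ω => ω.1.2.2.2 ≠ c.g₂ ω.1.2.1 (fun j => (ω.2 j).2.1))
      (fun ω hω => Or.inr (Or.inr (Or.inr hω.symm)))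
  · intro i
    refine (condEntropy_congr (Y := c.recv₂ i) (fun _ _ => Iff.rfl) fun ω ω' h => ?_).trans_le
      (condEntropy_le_entropy hp hp1 _ _)
    simp only [Prod.mk.injEq, prefixOf_eq_iff] at h
    rw [Code.output₂_eq (c := c), Code.output₂_eq (c := c),
      Code.input₂_congr (c := c) h.1.2 h.2, add_right_inj]
  · intro i
    have h1 : condEntropy (sampleProb W c) (c.recv₂ i) (auxVar i) =
        condEntropy (sampleProb W c) (fun ω => (ω.2 i).2.1) (auxVar i) := by
      refine condEntropy_congr (by simp) fun ω ω' h => ?_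
      rw [Code.output₂_eq (c := c), Code.output₂_eq (c := c),
        (inputs_congr_of_auxVar c h).2, add_right_inj]
    rw [h1]
    -- The auxiliary variable also contains the past of Y₁, so conditioning on it can only lower the
    -- entropy.
    refine condEntropy_anti hp _ fun ω ω' h => ?_
    simp only [auxVar, Prod.mk.injEq, prefixOf_eq_iff] at h ⊢
    exact ⟨⟨h.1.2.2, h.1.1, h.1.2.1⟩, fun j hj => (h.2 j hj).2⟩

end CodeEntropy

/-! ### Single-letter information quantities -/

section OutcomeEntropy

variable {q : ℕ} [NeZero q] {𝒴 𝒱 : Type*} [Fintype 𝒴] [Fintype 𝒱] (W : Channel q 𝒴)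
  {P : ZMod q × ZMod q × ZMod q × 𝒱 → ℝ}

/-- An outcome consists of the inputs with the auxiliary variable, and of `(Y₃, Z₁, Z₂)`. -/
def Outcome.mk' (a : ZMod q × ZMod q × ZMod q × 𝒱) (t : 𝒴 × ZMod q × ZMod q) : Outcome q 𝒴 𝒱 :=
  ⟨a.1, a.2.1, a.2.2.1, a.2.2.2, t.1, t.2.1, t.2.2⟩

lemma sum_outcomeProb_mul (P : ZMod q × ZMod q × ZMod q × 𝒱 → ℝ) (F : Outcome q 𝒴 𝒱 → ℝ) :
    ∑ o, W.outcomeProb P o * F o =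
      ∑ a, P a * ∑ t, W.kernel a.1 a.2.1 a.2.2.1 t * F (Outcome.mk' a t) := by
  let e : (ZMod q × ZMod q × ZMod q × 𝒱) × (𝒴 × ZMod q × ZMod q) ≃ Outcome q 𝒴 𝒱 :=
    { toFun := fun x => Outcome.mk' x.1 x.2
      invFun := fun o => ((o.X₁, o.X₂, o.X₃, o.V), (o.Y₃, o.Z₁, o.Z₂))
      left_inv := fun _ => rfl
      right_inv := fun _ => rfl }
  rw [← e.sum_comp, Fintype.sum_prod_type]
  refine sum_congr rfl fun a _ => ?_
  rw [mul_sum]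
  refine sum_congr rfl fun t _ => ?_
  change P a * _ * _ * _ * _ = P a * (_ * (_ * _) * F (Outcome.mk' a t))
  simp only [mul_assoc]
  rfl

omit [Fintype 𝒱] in
lemma outcomeProb_nonneg (hP : ∀ a, 0 ≤ P a) (o : Outcome q 𝒴 𝒱) : 0 ≤ W.outcomeProb P o :=
  mul_nonneg (mul_nonneg (mul_nonneg (hP _) ((W.PY3_mem _ _ _).1 _)) (W.PZ1_mem.1 _))
    (W.PZ2_mem.1 _)

lemma sum_outcomeProb (hP : ∑ a, P a = 1) : ∑ o, W.outcomeProb P o = 1 := by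
  simpa [W.sum_kernel, hP] using sum_outcomeProb_mul W P fun _ => 1

lemma sum_outcomeProb_mul_cond (P : ZMod q × ZMod q × ZMod q × 𝒱 → ℝ)
    (G : ZMod q × ZMod q × ZMod q × 𝒱 → 𝒴 × ZMod q × ZMod q → ℝ) :
    ∑ o, W.outcomeProb P o * G (o.X₁, o.X₂, o.X₃, o.V) (o.Y₃, o.Z₁, o.Z₂) =
      ∑ o, W.outcomeProb P o * ∑ t, W.kernel o.X₁ o.X₂ o.X₃ t * G (o.X₁, o.X₂, o.X₃, o.V) t := by
  rw [sum_outcomeProb_mul, sum_outcomeProb_mul]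
  refine sum_congr rfl fun a _ => ?_
  simp only [Outcome.mk', ← sum_mul, W.sum_kernel, one_mul]

lemma Channel.sum_kernel_mul_output (x₁ x₂ x₃ : ZMod q) (G : 𝒴 → ℝ) :
    ∑ t, W.kernel x₁ x₂ x₃ t * G t.1 = ∑ y, W.PY3 x₁ x₂ x₃ y * G y := by
  rw [Fintype.sum_prod_type]
  have : ∑ z : ZMod q × ZMod q, W.PZ1 z.1 * W.PZ2 z.2 = 1 := by
    simp only [Fintype.sum_prod_type, ← mul_sum, W.PZ2_mem.2, mul_one, W.PZ1_mem.2]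
  simp only [Channel.kernel, ← sum_mul, ← mul_sum, this, mul_one]

lemma Channel.sum_kernel_mul_noise₁ (x₁ x₂ x₃ : ZMod q) (G : ZMod q → ℝ) :
    ∑ t, W.kernel x₁ x₂ x₃ t * G t.2.1 = ∑ z, W.PZ1 z * G z := by
  rw [Channel.sum_kernel_mul_noise W x₁ x₂ x₃ fun z => G z.1, Fintype.sum_prod_type]
  simp only [← sum_mul, ← mul_sum, W.PZ2_mem.2, mul_one]

variable {β γ : Type*} [Fintype β] [Fintype γ]

/-- One formula for all three multiple-access terms: `C` and `B` jointly carry the three inputs, and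
the entropy subtracted is linear in the input law. -/
lemma condMutualInfo_output (hP : ∀ a, 0 ≤ P a) (C : Outcome q 𝒴 𝒱 → γ) (B : Outcome q 𝒴 𝒱 → β)
    (h : ∀ o o', (C o, B o) = (C o', B o') ↔ (o.X₁, o.X₂, o.X₃) = (o'.X₁, o'.X₂, o'.X₃)) :
    condMutualInfo (W.outcomeProb P) C (·.Y₃) B = condEntropy (W.outcomeProb P) (·.Y₃) B -
      ∑ o, W.outcomeProb P o * massEntropy (W.PY3 o.X₁ o.X₂ o.X₃) := by
  rw [condMutualInfo_symm, condEntropy_congr (Y := (·.Y₃)) h (by simp)]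
  congr 1
  refine condEntropy_eq_of_condLaw (outcomeProb_nonneg W hP)
    (fun o : Outcome q 𝒴 𝒱 => (o.X₁, o.X₂, o.X₃)) _ _
    (fun o o' h => congrArg (fun x : ZMod q × ZMod q × ZMod q => W.PY3 x.1 x.2.1 x.2.2) h) ?_
  intro G
  simpa only [Channel.sum_kernel_mul_output W _ _ _ (G _)] using
    sum_outcomeProb_mul_cond W P fun a t => G (a.1, a.2.1, a.2.2.1) t.1

/-- Given X₃, the sum X₃ + Z₁ and Z₁ determine each other, and Z₁ is independent of (X₃, V). -/
lemma condMutualInfo_input₃ (hP : P ∈ stdSimplex ℝ (ZMod q × ZMod q × ZMod q × 𝒱)) :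
    condMutualInfo (W.outcomeProb P) (·.X₃) (fun ω => ω.X₃ + ω.Z₁) (·.V) =
      condEntropy (W.outcomeProb P) (fun ω => ω.X₃ + ω.Z₁) (·.V) - massEntropy W.PZ1 := by
  rw [condMutualInfo_symm]
  congr 1
  have h : condEntropy (W.outcomeProb P) (fun ω => ω.X₃ + ω.Z₁) (fun ω => (ω.X₃, ω.V)) =
      condEntropy (W.outcomeProb P) (·.Z₁) (fun ω => (ω.X₃, ω.V)) :=
    condEntropy_congr (fun _ _ => Iff.rfl)
      (by simp only [Prod.mk.injEq]; rintro o o' ⟨h, -⟩; rw [h, add_right_inj])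
  rw [h, condEntropy_eq_of_condLaw (outcomeProb_nonneg W hP.1)
    (fun o : Outcome q 𝒴 𝒱 => (o.X₃, o.V)) (·.Z₁) (fun _ => W.PZ1) (fun _ _ _ => rfl),
    ← sum_mul, sum_outcomeProb W hP.2, one_mul]
  intro G
  simpa only [Channel.sum_kernel_mul_noise₁ W _ _ _ (G _)] using
    sum_outcomeProb_mul_cond W P fun a t => G (a.2.2.1, a.2.2.2) t.2.1

end OutcomeEntropy

/-! ### Uniform time index -/

section TimeSharing

variable {Ω α β : Type*} [Fintype Ω] [Fintype α] [Fintype β] {p : Ω → ℝ} {n : ℕ}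

/-- The law of a uniform time index together with an independent outcome. -/
noncomputable def timeShared (n : ℕ) (p : Ω → ℝ) (x : Fin n × Ω) : ℝ := (n : ℝ)⁻¹ * p x.2

omit [Fintype Ω] in
lemma timeShared_nonneg (hp : ∀ ω, 0 ≤ p ω) (x : Fin n × Ω) : 0 ≤ timeShared n p x :=
  mul_nonneg (by positivity) (hp _)

lemma sum_timeShared_mul (F : Fin n × Ω → ℝ) :
    ∑ x, timeShared n p x * F x = (n : ℝ)⁻¹ * ∑ i, ∑ ω, p ω * F (i, ω) := by
  simp only [Fintype.sum_prod_type, timeShared, mul_assoc, ← mul_sum]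

omit [Fintype α] in
lemma law_timeShared (X : Fin n → Ω → α) (i : Fin n) (a : α) :
    law (timeShared n p) (fun x => (x.1, X x.1 x.2)) (i, a) = (n : ℝ)⁻¹ * law p (X i) a := by
  classical
  have := sum_timeShared_mul (p := p) fun x : Fin n × Ω => if (x.1, X x.1 x.2) = (i, a) then 1 else 0
  simp only [mul_ite, mul_one, mul_zero, Prod.mk.injEq, ite_and] at this
  rw [Finset.sum_eq_single i (by intro j _ hj; simp [hj]) (by simp)] at this
  simpa [law, Prod.mk.injEq, ite_and] using this

lemma entropy_timeShared (hp : ∀ ω, 0 ≤ p ω) (hp1 : ∑ ω, p ω = 1) (hn : 0 < n)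
    (X : Fin n → Ω → α) :
    entropy (timeShared n p) (fun x => (x.1, X x.1 x.2)) =
      logb 2 n + (n : ℝ)⁻¹ * ∑ i, entropy p (X i) := by
  have hn' : (n : ℝ) ≠ 0 := by positivity
  simp only [entropy_eq, law_timeShared]
  rw [sum_timeShared_mul]
  have : ∀ i, ∑ ω, p ω * logb 2 ((n : ℝ)⁻¹ * law p (X i) (X i ω)) =
      -logb 2 n + ∑ ω, p ω * logb 2 (law p (X i) (X i ω)) := by
    intro i
    rw [← one_mul (-logb 2 (n : ℝ)), ← hp1, sum_mul, ← sum_add_distrib]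
    refine sum_congr rfl fun ω _ => ?_
    rcases (hp ω).eq_or_lt with h0 | h0
    · simp [← h0]
    rw [logb_mul (inv_ne_zero hn') (h0.trans_le (le_law hp (X i) ω)).ne', logb_inv]
    ring
  simp only [this, sum_add_distrib, sum_neg_distrib, sum_const, card_univ, Fintype.card_fin,
    nsmul_eq_mul]
  field_simp
  ring

lemma condEntropy_timeShared (hp : ∀ ω, 0 ≤ p ω) (hp1 : ∑ ω, p ω = 1) (hn : 0 < n)
    (X : Fin n → Ω → α) (Z : Fin n → Ω → β) :
    condEntropy (timeShared n p) (fun x => X x.1 x.2) (fun x => (x.1, Z x.1 x.2)) =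
      (n : ℝ)⁻¹ * ∑ i, condEntropy p (X i) (Z i) := by
  rw [condEntropy, entropy_congr (Y := fun x => (x.1, X x.1 x.2, Z x.1 x.2))
    (by simp only [Prod.mk.injEq]; grind),
    entropy_timeShared hp hp1 hn fun i ω => (X i ω, Z i ω), entropy_timeShared hp hp1 hn]
  simp only [condEntropy, sum_sub_distrib]
  ring

/-- The average is the conditional entropy given the time index as well; omitting the index can only
increase it. This is concavity of conditional entropy. -/
lemma sum_condEntropy_le (hp : ∀ ω, 0 ≤ p ω) (hp1 : ∑ ω, p ω = 1) (hn : 0 < n)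
    (X : Fin n → Ω → α) (Z : Fin n → Ω → β) :
    ∑ i, condEntropy p (X i) (Z i) ≤
      n * condEntropy (timeShared n p) (fun x => X x.1 x.2) (fun x => Z x.1 x.2) := by
  have hn' : (0 : ℝ) < n := by positivity
  rw [← div_le_iff₀' hn', div_eq_inv_mul, ← condEntropy_timeShared hp hp1 hn]
  exact condEntropy_anti (timeShared_nonneg hp) _ (by simp only [Prod.mk.injEq]; grind)

lemma sum_entropy_le (hp : ∀ ω, 0 ≤ p ω) (hp1 : ∑ ω, p ω = 1) (hn : 0 < n)
    (X : Fin n → Ω → α) :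
    ∑ i, entropy p (X i) ≤ n * entropy (timeShared n p) (fun x => X x.1 x.2) := by
  have h1 : ∑ x, timeShared n p x = 1 := by
    have : (n : ℝ) ≠ 0 := by positivity
    simpa [hp1, this] using sum_timeShared_mul (n := n) (p := p) fun _ => 1
  have := sum_condEntropy_le hp hp1 hn X fun _ _ => ()
  simpa only [condEntropy_const hp1 _ (Z := fun _ => ()) (by simp),
    condEntropy_const h1 _ (Z := fun _ => ()) (by simp)] using this

end TimeSharing

/-! ### Single-letter converse for a fixed block length -/

section SingleLetter

variable {q : ℕ} [NeZero q] {𝒴 : Type*} [Fintype 𝒴] {n : ℕ} {R₁₃ R₂₃ R₃₁ R₃₂ : ℝ}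
  (W : Channel q 𝒴) (c : Code q 𝒴 n R₁₃ R₂₃ R₃₁ R₃₂)

/-- The alphabet of the time-shared auxiliary variable. -/
abbrev AuxAlphabet (q n : ℕ) (R₁₃ R₂₃ R₃₂ : ℝ) : Type :=
  Fin n × (Msg n R₁₃ × Msg n R₂₃ × Msg n R₃₂) × (Fin n → Option (ZMod q × ZMod q))

/-- The inputs at a time together with the auxiliary variable. -/
def codeInputs (x : Fin n × Sample q 𝒴 n R₁₃ R₂₃ R₃₁ R₃₂) :
    ZMod q × ZMod q × ZMod q × AuxAlphabet q n R₁₃ R₂₃ R₃₂ :=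
  (c.input₁ x.1 x.2, c.input₂ x.1 x.2, c.input₃ x.1 x.2, x.1, auxVar x.1 x.2)

/-- The single-letter outcome produced by the code at a time. -/
def codeOutcome (x : Fin n × Sample q 𝒴 n R₁₃ R₂₃ R₃₁ R₃₂) :
    Outcome q 𝒴 (AuxAlphabet q n R₁₃ R₂₃ R₃₂) :=
  Outcome.mk' (codeInputs c x) (c.obs x.1 x.2)

/-- At each time the inputs and the auxiliary variable are functions of the messages and the past
outputs, so (Y₃, Z₁, Z₂) depends on them only through the channel. -/
lemma law_codeOutcome :
    law (timeShared n (sampleProb W c)) (codeOutcome c) =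
      W.outcomeProb (law (timeShared n (sampleProb W c)) (codeInputs c)) := by
  classical
  have key : ∀ F : Outcome q 𝒴 (AuxAlphabet q n R₁₃ R₂₃ R₃₂) → ℝ,
      ∑ x, timeShared n (sampleProb W c) x * F (codeOutcome c x) =
        ∑ o, W.outcomeProb (law (timeShared n (sampleProb W c)) (codeInputs c)) o * F o := by
    intro F
    rw [sum_outcomeProb_mul, sum_law_mul _ _ fun a =>
      ∑ t, W.kernel a.1 a.2.1 a.2.2.1 t * F (Outcome.mk' a t), sum_timeShared_mul,
      sum_timeShared_mul]
    congr 1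
    refine sum_congr rfl fun i _ => ?_
    -- The inputs and the padded prefix have to be written as functions of messages and past alone.
    exact sum_sampleProb_mul W c i fun a t => F (Outcome.mk'
      (c.f₁ i a.1.1 fun j => (a.2 j).1, c.f₂ i a.1.2.1 fun j => (a.2 j).2.1,
        c.f₃ i a.1.2.2.1 a.1.2.2.2 fun j => (a.2 j).2.2, i, (a.1.1, a.1.2.1, a.1.2.2.2),
        fun j => if h : (j : ℕ) < i then some ((a.2 ⟨j, h⟩).1, (a.2 ⟨j, h⟩).2.1) else none) t)
  funext o
  have := key fun o' => if o' = o then 1 else 0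
  simpa [law] using this

/-- The single-letter converse for block length `n`. -/
lemma exists_single_letter (hn : 0 < n) (hp1 : ∑ ω, sampleProb W c ω = 1) :
    ∃ P ∈ stdSimplex ℝ (ZMod q × ZMod q × ZMod q × AuxAlphabet q n R₁₃ R₂₃ R₃₂),
      (1 - errorProb W c) * logb 2 (Fintype.card (Msg n R₁₃)) - 1 ≤
        n * condMutualInfo (W.outcomeProb P) (·.X₁) (·.Y₃) (fun ω => (ω.X₂, ω.X₃)) ∧
      (1 - errorProb W c) * logb 2 (Fintype.card (Msg n R₂₃)) - 1 ≤
        n * condMutualInfo (W.outcomeProb P) (·.X₂) (·.Y₃) (fun ω => (ω.X₁, ω.X₃)) ∧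
      (1 - errorProb W c) * logb 2 (Fintype.card (Msg n R₁₃ × Msg n R₂₃)) - 1 ≤
        n * condMutualInfo (W.outcomeProb P) (fun ω => (ω.X₁, ω.X₂)) (·.Y₃) (·.X₃) ∧
      (1 - errorProb W c) * logb 2 (Fintype.card (Msg n R₃₁)) - 1 ≤
        n * condMutualInfo (W.outcomeProb P) (·.X₃) (fun ω => ω.X₃ + ω.Z₁) (·.V) ∧
      (1 - errorProb W c) * logb 2 (Fintype.card (Msg n R₃₂)) - 1 ≤
        n * mutualInfo (W.outcomeProb P) (·.V) (fun ω => ω.X₃ + ω.Z₁ + ω.Z₂) := by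
  set p := sampleProb W c with hpdef
  have hp : ∀ ω, 0 ≤ p ω := sampleProb_nonneg W c
  set P := law (timeShared n p) (codeInputs c) with hPdef
  have hn' : (n : ℝ) ≠ 0 := by positivity
  have hP0 : ∀ a, 0 ≤ P a := law_nonneg (timeShared_nonneg hp) _
  have hP1 : ∑ a, P a = 1 := by
    rw [hPdef, sum_law]
    simpa [hp1, hn'] using sum_timeShared_mul (n := n) (p := p) fun _ => 1
  have hlaw : W.outcomeProb P = law (timeShared n p) (codeOutcome c) := (law_codeOutcome W c).symm
  have hout : ∑ i, outputEntropy W c i =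
      n * ∑ o, W.outcomeProb P o * massEntropy (W.PY3 o.X₁ o.X₂ o.X₃) := by
    rw [hlaw, sum_law_mul _ _ fun o : Outcome q 𝒴 (AuxAlphabet q n R₁₃ R₂₃ R₃₂) =>
      massEntropy (W.PY3 o.X₁ o.X₂ o.X₃), sum_timeShared_mul, mul_inv_cancel_left₀ hn']
    rfl
  have hmac : ∀ {β γ : Type} [Fintype β] [Fintype γ]
      (C : Outcome q 𝒴 (AuxAlphabet q n R₁₃ R₂₃ R₃₂) → γ)
      (B : Outcome q 𝒴 (AuxAlphabet q n R₁₃ R₂₃ R₃₂) → β)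
      (_ : ∀ o o', (C o, B o) = (C o', B o') ↔ (o.X₁, o.X₂, o.X₃) = (o'.X₁, o'.X₂, o'.X₃)),
      ∑ i, (condEntropy p (fun ω => (ω.2 i).2.2) (fun ω => B (codeOutcome c (i, ω))) -
        outputEntropy W c i) ≤ n * condMutualInfo (W.outcomeProb P) C (·.Y₃) B := by
    intro β γ _ _ C B h
    rw [condMutualInfo_output W hP0 C B h, mul_sub, sum_sub_distrib, hout]
    -- The time index is dropped from the condition here; the subtracted term is linear and was
    -- matched exactly.
    refine sub_le_sub_right ((sum_condEntropy_le hp hp1 hn _ _).trans_eq ?_) _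
    simp only [hlaw, condEntropy, entropy_law]
    rfl
  refine ⟨P, ⟨hP0, hP1⟩, ?_, ?_, ?_, ?_, ?_⟩
  · have h1 := mac_converse W c hp1 (fun m => m.2) (fun m => m.1)
      (fun m m' h h' => Prod.ext h h') (by simp only [Fintype.card_prod])
      (fun i ω => (c.input₂ i ω, c.input₃ i ω))
      (fun i ω ω' h h' => Prod.ext (Code.input₂_congr_obs (congrArg Prod.snd h)
        (congrArg Prod.fst h) h') (Code.input₃_congr_obs (congrArg Prod.snd h) h'))
      (fun y b => (c.g₃ b.2.1 b.2.2 y).1) (fun ω h => Or.inl h.symm)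
    have h2 := hmac (·.X₁) (fun ω => (ω.X₂, ω.X₃)) (by simp only [Prod.mk.injEq]; grind)
    have h3 := h1.trans (add_le_add_right h2 _)
    linarith
  · have h1 := mac_converse W c hp1 (fun m => (m.1, m.2.2)) (fun m => m.2.1)
      (fun m m' h h' => Prod.ext (Prod.mk.inj h').1 (Prod.ext h (Prod.mk.inj h').2))
      (by simp only [Fintype.card_prod]; ring)
      (fun i ω => (c.input₁ i ω, c.input₃ i ω))
      (fun i ω ω' h h' => Prod.ext (Code.input₁_congr_obs (Prod.mk.inj h).2
        (Prod.mk.inj h).1 h') (Code.input₃_congr_obs (Prod.mk.inj h).2 h'))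
      (fun y b => (c.g₃ b.2.1 b.2.2 y).2) (fun ω h => Or.inr h.symm)
    have h2 := hmac (·.X₂) (fun ω => (ω.X₁, ω.X₃)) (by simp only [Prod.mk.injEq]; grind)
    have h3 := h1.trans (add_le_add_right h2 _)
    linarith
  · have h1 := mac_converse W c hp1 (fun m => m.2.2) (fun m => (m.1, m.2.1))
      (fun m m' h h' => Prod.ext (Prod.mk.inj h).1 (Prod.ext (Prod.mk.inj h).2 h'))
      (by simp only [Fintype.card_prod]; ring)
      (fun i ω => c.input₃ i ω)
      (fun i ω ω' h h' => Code.input₃_congr_obs h h')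
      (fun y b => c.g₃ b.1 b.2 y) (fun ω h => by
        by_contra hcon
        push Not at hcon
        exact h (Prod.ext hcon.1.symm hcon.2.symm))
    have h2 := hmac (fun ω => (ω.X₁, ω.X₂)) (·.X₃) (by simp only [Prod.mk.injEq]; grind)
    have h3 := h1.trans (add_le_add_right h2 _)
    linarith
  · have h1 := broadcast_converse₁ W c hp1
    have h2 : ∑ i, (condEntropy p (c.recv₁ i) (auxVar i) - massEntropy W.PZ1) =
        n * condMutualInfo (W.outcomeProb P) (·.X₃) (fun ω => ω.X₃ + ω.Z₁) (·.V) := by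
      rw [condMutualInfo_input₃ W ⟨hP0, hP1⟩, sum_sub_distrib, mul_sub]
      congr 1
      -- Equality holds because the time index is a component of V.
      · rw [← mul_inv_cancel_left₀ hn' (∑ i, condEntropy p (c.recv₁ i) (auxVar i)),
          ← condEntropy_timeShared hp hp1 hn]
        simp only [hlaw, condEntropy, entropy_law]
        rfl
      · simp
    rw [h2] at h1
    linarith
  · have h1 := broadcast_converse₂ W c hp1
    have h2 : ∑ i, (entropy p (c.recv₂ i) - condEntropy p (c.recv₂ i) (auxVar i)) ≤
        n * mutualInfo (W.outcomeProb P) (·.V) (fun ω => ω.X₃ + ω.Z₁ + ω.Z₂) := by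
      rw [mutualInfo_symm, sum_sub_distrib, mul_sub]
      refine sub_le_sub ((sum_entropy_le hp hp1 hn _).trans_eq ?_) (le_of_eq ?_)
      · rw [hlaw, entropy_law]
        rfl
      · rw [← mul_inv_cancel_left₀ hn' (∑ i, condEntropy p (c.recv₂ i) (auxVar i)),
          ← condEntropy_timeShared hp hp1 hn]
        simp only [hlaw, condEntropy, entropy_law]
        rfl
    have h3 := h1.trans (add_le_add_right h2 _)
    linarith

end SingleLetter

/-! ### Support reduction of Carathéodory type -/

section Support

variable {ι κ : Type*} [Fintype ι] [Fintype κ] [DecidableEq ι]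

/-- More than `card κ` active rows are linearly dependent. Moving the weights along a dependency
keeps the linear quantities; its sign is chosen so that the `g`-sum does not grow, and the motion
stops when a weight first vanishes. A one-sided condition on `g` therefore costs no extra support
point. -/
lemma exists_smaller_support (A : ι → κ → ℝ) (φ : κ → ℝ) (g w : ι → ℝ) (hw : ∀ i, 0 ≤ w i)
    (hφ : ∀ i, w i ≠ 0 → 0 < ∑ k, φ k * A i k)
    (hcard : Fintype.card κ < #{i | w i ≠ 0}) :
    ∃ w' : ι → ℝ, (∀ i, 0 ≤ w' i) ∧ #{i | w' i ≠ 0} < #{i | w i ≠ 0} ∧ (∀ i, w i = 0 → w' i = 0) ∧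
      (∀ k, ∑ i, w' i * A i k = ∑ i, w i * A i k) ∧ ∑ i, w' i * g i ≤ ∑ i, w i * g i := by
  set s : Finset ι := {i | w i ≠ 0} with hs
  have hdep : ¬ LinearIndependent ℝ (fun i : s => A i) := by
    intro h
    have := h.fintype_card_le_finrank
    simp only [Fintype.card_coe, Module.finrank_fintype_fun_eq_card] at this
    omega
  obtain ⟨d₀, hd₀, i₀, hi₀⟩ := Fintype.not_linearIndependent_iff.1 hdep
  obtain ⟨d, hdA, hds, i₁, hi₁, hdg⟩ : ∃ d : ι → ℝ, (∀ k, ∑ i, d i * A i k = 0) ∧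
      (∀ i, d i ≠ 0 → w i ≠ 0) ∧ (∃ i, d i ≠ 0 ∧ ∑ i, d i * g i ≤ 0) := by
    set d : ι → ℝ := fun i => if h : i ∈ s then d₀ ⟨i, h⟩ else 0 with hd
    have h1 : ∀ k, ∑ i, d i * A i k = 0 := by
      intro k
      have h := congrFun hd₀ k
      simp only [Finset.sum_apply, Pi.smul_apply, smul_eq_mul, Pi.zero_apply] at h
      rw [← h, ← Finset.sum_subset (Finset.subset_univ s) (by intro i _ hi; simp [hd, hi]),
        ← Finset.sum_coe_sort]
      exact sum_congr rfl fun i _ => by simp [hd]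
    have h2 : ∀ i, d i ≠ 0 → w i ≠ 0 := by
      intro i hi
      by_contra h
      exact hi (by simp [hd, hs, h])
    have h3 : d i₀ ≠ 0 := by simpa [hd] using hi₀
    rcases le_total (∑ i, d i * g i) 0 with h | h
    · exact ⟨d, h1, h2, i₀, h3, h⟩
    · refine ⟨fun i => -d i, fun k => ?_, fun i hi => h2 i (by simpa using hi), i₀,
        by simpa using h3, ?_⟩
      · simp [h1]
      · simpa using h
  -- The functional given by `φ` is positive on every active row but sums to zero against `d`, so
  -- `d` cannot be nonnegative.
  have hneg : ∃ i, d i < 0 := by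
    by_contra hcon
    push Not at hcon
    have h0 : ∑ i, d i * ∑ k, φ k * A i k = 0 := by
      simp only [mul_sum]
      rw [sum_comm]
      refine sum_eq_zero fun k _ => ?_
      rw [← mul_zero (φ k), ← hdA k, mul_sum]
      exact sum_congr rfl fun i _ => by ring
    have hnn : ∀ i ∈ univ, 0 ≤ d i * ∑ k, φ k * A i k := by
      intro i _
      by_cases hi : d i = 0
      · simp [hi]
      · exact mul_nonneg (hcon i) (hφ i (hds i hi)).le
    have := (sum_eq_zero_iff_of_nonneg hnn).1 h0 i₁ (mem_univ _)
    exact (mul_pos (lt_of_le_of_ne (hcon i₁) (Ne.symm hi₁)) (hφ i₁ (hds i₁ hi₁))).ne' this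
  -- The minimal ratio is the largest step that keeps all weights nonnegative.
  obtain ⟨i, hi, hmin⟩ := Finset.exists_min_image {i | d i < 0} (fun i => w i / -d i)
    (by obtain ⟨i, hi⟩ := hneg; exact ⟨i, by simpa using hi⟩)
  simp only [mem_filter, mem_univ, true_and] at hi hmin
  set t := w i / -d i with ht
  have ht0 : 0 ≤ t := div_nonneg (hw i) (by linarith)
  have hzero : w i + t * d i = 0 := by
    rw [ht, div_neg, neg_mul, div_mul_cancel₀ _ hi.ne, add_neg_cancel]
  have hkeep : ∀ j, w j = 0 → w j + t * d j = 0 := by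
    intro j h
    have hd : d j = 0 := by
      by_contra hd
      exact hds j hd h
    simp [h, hd]
  refine ⟨fun j => w j + t * d j, fun j => ?_, ?_, hkeep, fun k => ?_, ?_⟩
  · rcases le_or_gt 0 (d j) with h | h
    · exact add_nonneg (hw j) (mul_nonneg ht0 h)
    · have := hmin j h
      rw [le_div_iff₀ (by linarith)] at this
      linarith
  · refine Finset.card_lt_card ((Finset.ssubset_iff_of_subset fun j hj => ?_).2
      ⟨i, by simpa [hs] using hds i hi.ne, by simp [hzero]⟩)
    simp only [mem_filter, mem_univ, true_and, hs] at hj ⊢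
    exact fun h => hj (hkeep j h)
  · simp only [add_mul, sum_add_distrib, mul_assoc, ← mul_sum, hdA k, mul_zero, add_zero]
  · simp only [add_mul, sum_add_distrib, mul_assoc, ← mul_sum]
    nlinarith

/-- Nonnegative weights can be replaced by weights with at most `card κ` nonzero entries that keep
`card κ` linear quantities and do not increase another one. -/
lemma exists_small_support (A : ι → κ → ℝ) (φ : κ → ℝ) (g w : ι → ℝ) (hw : ∀ i, 0 ≤ w i)
    (hφ : ∀ i, w i ≠ 0 → 0 < ∑ k, φ k * A i k) :
    ∃ w' : ι → ℝ, (∀ i, 0 ≤ w' i) ∧ #{i | w' i ≠ 0} ≤ Fintype.card κ ∧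
      (∀ k, ∑ i, w' i * A i k = ∑ i, w i * A i k) ∧ ∑ i, w' i * g i ≤ ∑ i, w i * g i := by
  induction hc : #{i | w i ≠ 0} using Nat.strong_induction_on generalizing w with
  | _ m ih =>
    by_cases hm : m ≤ Fintype.card κ
    · exact ⟨w, hw, hc ▸ hm, fun _ => rfl, le_rfl⟩
    obtain ⟨w₁, h1, h2, h5, h3, h4⟩ := exists_smaller_support A φ g w hw hφ (by omega)
    obtain ⟨w₂, k1, k2, k3, k4⟩ := ih _ (hc ▸ h2) w₁ h1
      (fun i hi => hφ i fun h => hi (h5 i h)) rfl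
    exact ⟨w₂, k1, k2, fun k => (k3 k).trans (h3 k), k4.trans h4⟩

end Support

/-! ### Bounding the auxiliary alphabet -/

section Cardinality

variable {q : ℕ} [NeZero q] {𝒴 𝒱 𝒱' : Type*} [Fintype 𝒴] [Fintype 𝒱] [Fintype 𝒱']
  (W : Channel q 𝒴)

/-- The law of the inputs. -/
def inputLaw (P : ZMod q × ZMod q × ZMod q × 𝒱 → ℝ) (x₁ x₂ x₃ : ZMod q) : ℝ :=
  ∑ v, P (x₁, x₂, x₃, v)

/-- The joint law of the auxiliary variable and `X₃`. -/
def auxLaw (P : ZMod q × ZMod q × ZMod q × 𝒱 → ℝ) (v : 𝒱) (x₃ : ZMod q) : ℝ :=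
  ∑ x₁, ∑ x₂, P (x₁, x₂, x₃, v)

/-- The probability that adding the noise `f (Z₁, Z₂)` to `x` gives `s`. -/
noncomputable def Channel.noiseKernel (f : ZMod q × ZMod q → ZMod q) (x s : ZMod q) : ℝ :=
  ∑ z : ZMod q × ZMod q, W.PZ1 z.1 * W.PZ2 z.2 * if x + f z = s then 1 else 0

/-- The contribution of a symbol of the auxiliary variable to `H(X₃ + f (Z₁, Z₂) | V)`, as a
function of its unnormalised conditional law of `X₃`. -/
noncomputable def Channel.condTerm (f : ZMod q × ZMod q → ZMod q) (r : ZMod q → ℝ) : ℝ :=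
  massEntropy (fun s => ∑ x, r x * W.noiseKernel f x s) + (∑ x, r x) * logb 2 (∑ x, r x)

lemma Channel.sum_noiseKernel (f : ZMod q × ZMod q → ZMod q) (x : ZMod q) :
    ∑ s, W.noiseKernel f x s = 1 := by
  simp only [Channel.noiseKernel]
  rw [sum_comm]
  simp only [← mul_sum, sum_ite_eq, mem_univ, if_true, mul_one]
  simp only [Fintype.sum_prod_type, ← mul_sum, W.PZ2_mem.2, mul_one, W.PZ1_mem.2]

/-- Homogeneity of degree one makes H(X₃ + f(Z₁, Z₂) | V) linear in a reweighting of the symbols of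
V. -/
lemma Channel.condTerm_smul (f : ZMod q × ZMod q → ZMod q) (r : ZMod q → ℝ) (a : ℝ) :
    W.condTerm f (fun x => a * r x) = a * W.condTerm f r := by
  by_cases ha : a = 0
  · simp [Channel.condTerm, massEntropy, ha]
  have hlog : ∀ b : ℝ, a * b * logb 2 (a * b) = a * (b * logb 2 a) + a * (b * logb 2 b) := by
    intro b
    by_cases hb : b = 0
    · simp [hb]
    rw [logb_mul ha hb]
    ring
  have htot : ∑ s, ∑ x, r x * W.noiseKernel f x s = ∑ x, r x := by
    rw [sum_comm]
    simp only [← mul_sum, W.sum_noiseKernel, mul_one]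
  have hmul : ∀ s, ∑ x, a * r x * W.noiseKernel f x s = a * ∑ x, r x * W.noiseKernel f x s :=
    fun s => by simp only [mul_sum, mul_assoc]
  simp only [Channel.condTerm, massEntropy, hmul, hlog, sum_add_distrib]
  rw [← mul_sum, ← mul_sum, ← mul_sum, ← sum_mul, htot, hlog]
  ring

variable (P : ZMod q × ZMod q × ZMod q × 𝒱 → ℝ)

lemma sum_outcomeProb_mul_output (F : ZMod q × ZMod q × ZMod q × 𝒴 → ℝ) :
    ∑ o : Outcome q 𝒴 𝒱, W.outcomeProb P o * F (o.X₁, o.X₂, o.X₃, o.Y₃) =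
      ∑ x₁, ∑ x₂, ∑ x₃, inputLaw P x₁ x₂ x₃ * ∑ y, W.PY3 x₁ x₂ x₃ y * F (x₁, x₂, x₃, y) := by
  rw [sum_outcomeProb_mul]
  simp only [Outcome.mk', Fintype.sum_prod_type (α₁ := ZMod q), inputLaw, sum_mul]
  refine sum_congr rfl fun x₁ _ => sum_congr rfl fun x₂ _ => sum_congr rfl fun x₃ _ =>
    sum_congr rfl fun v _ => ?_
  rw [W.sum_kernel_mul_output x₁ x₂ x₃ fun y => F (x₁, x₂, x₃, y)]

lemma sum_outcomeProb_mul_aux (F : ZMod q → 𝒱 → ZMod q × ZMod q → ℝ) :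
    ∑ o : Outcome q 𝒴 𝒱, W.outcomeProb P o * F o.X₃ o.V (o.Z₁, o.Z₂) =
      ∑ v, ∑ x, auxLaw P v x * ∑ z : ZMod q × ZMod q, W.PZ1 z.1 * W.PZ2 z.2 * F x v z := by
  rw [sum_outcomeProb_mul]
  simp only [Outcome.mk', auxLaw, sum_mul]
  rw [Fintype.sum_prod_type]
  simp only [Fintype.sum_prod_type (α₂ := ZMod q × 𝒱)]
  have h : ∀ x₁ x₂ x₃ v, ∑ t : 𝒴 × ZMod q × ZMod q, W.kernel x₁ x₂ x₃ t * F x₃ v (t.2.1, t.2.2) =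
      ∑ z : ZMod q × ZMod q, W.PZ1 z.1 * W.PZ2 z.2 * F x₃ v z :=
    fun x₁ x₂ x₃ v => W.sum_kernel_mul_noise x₁ x₂ x₃ fun z => F x₃ v z
  simp only [h]
  calc _ = ∑ x₁, ∑ x₂, ∑ v, ∑ x₃, P (x₁, x₂, x₃, v) *
        ∑ z : ZMod q × ZMod q, W.PZ1 z.1 * W.PZ2 z.2 * F x₃ v z := by
        refine sum_congr rfl fun x₁ _ => sum_congr rfl fun x₂ _ => ?_
        rw [Fintype.sum_prod_type, sum_comm]
    _ = ∑ x₁, ∑ v, ∑ x₂, ∑ x₃, P (x₁, x₂, x₃, v) *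
        ∑ z : ZMod q × ZMod q, W.PZ1 z.1 * W.PZ2 z.2 * F x₃ v z :=
        sum_congr rfl fun x₁ _ => sum_comm
    _ = ∑ v, ∑ x₁, ∑ x₃, ∑ x₂, P (x₁, x₂, x₃, v) *
        ∑ z : ZMod q × ZMod q, W.PZ1 z.1 * W.PZ2 z.2 * F x₃ v z := by
        rw [sum_comm]
        exact sum_congr rfl fun v _ => sum_congr rfl fun x₁ _ => sum_comm
    _ = _ := sum_congr rfl fun v _ => sum_comm

lemma law_noise_aux (f : ZMod q × ZMod q → ZMod q) (s : ZMod q) (v : 𝒱) :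
    law (W.outcomeProb P) (fun o => (o.X₃ + f (o.Z₁, o.Z₂), o.V)) (s, v) =
      ∑ x, auxLaw P v x * W.noiseKernel f x s := by
  classical
  have := sum_outcomeProb_mul_aux W P fun x v' z => if v' = v then if x + f z = s then 1 else 0 else 0
  rw [Finset.sum_eq_single v (by intro v' _ hv; simp [hv]) (by simp)] at this
  simp only [if_true] at this
  rw [law]
  simp only [Channel.noiseKernel, ← this]
  refine sum_congr rfl fun o _ => ?_
  by_cases h1 : o.V = v <;> by_cases h2 : o.X₃ + f (o.Z₁, o.Z₂) = s <;> simp [h1, h2]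

lemma law_aux (v : 𝒱) : law (W.outcomeProb P) (·.V) v = ∑ x, auxLaw P v x := by
  classical
  have := sum_outcomeProb_mul_aux W P fun _ v' _ => if v' = v then 1 else 0
  rw [Finset.sum_eq_single v (by intro v' _ hv; simp [hv]) (by simp)] at this
  simp only [if_true, mul_one, Fintype.sum_prod_type, ← mul_sum, W.PZ2_mem.2, W.PZ1_mem.2]
    at this
  rw [← this]
  simp [law]

lemma condEntropy_noise_aux (f : ZMod q × ZMod q → ZMod q) :
    condEntropy (W.outcomeProb P) (fun o => o.X₃ + f (o.Z₁, o.Z₂)) (·.V) =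
      ∑ v, W.condTerm f (auxLaw P v) := by
  simp only [condEntropy, entropy, Fintype.sum_prod_type_right, law_noise_aux, law_aux,
    Channel.condTerm, massEntropy, sum_add_distrib, sum_neg_distrib]
  ring

variable {P} {P' : ZMod q × ZMod q × ZMod q × 𝒱' → ℝ}

lemma entropy_noise_congr (h : ∀ x, ∑ v, auxLaw P v x = ∑ v, auxLaw P' v x)
    (f : ZMod q × ZMod q → ZMod q) :
    entropy (W.outcomeProb P) (fun o => o.X₃ + f (o.Z₁, o.Z₂)) =
      entropy (W.outcomeProb P') (fun o => o.X₃ + f (o.Z₁, o.Z₂)) := by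
  classical
  have : ∀ s, law (W.outcomeProb P) (fun o => o.X₃ + f (o.Z₁, o.Z₂)) s =
      law (W.outcomeProb P') (fun o => o.X₃ + f (o.Z₁, o.Z₂)) s := by
    intro s
    have h1 := sum_outcomeProb_mul_aux W P fun x _ z => if x + f z = s then 1 else 0
    have h2 := sum_outcomeProb_mul_aux W P' fun x _ z => if x + f z = s then 1 else 0
    rw [sum_comm] at h1 h2
    simp only [← sum_mul, h] at h1 h2
    have h3 := h1.trans h2.symm
    simp only [mul_ite, mul_one, mul_zero] at h3
    simp only [law]
    convert h3
  simp only [entropy, this]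

lemma entropy_output_congr (h : inputLaw P = inputLaw P') {α : Type*} [Fintype α]
    (F : ZMod q × ZMod q × ZMod q × 𝒴 → α) :
    entropy (W.outcomeProb P) (fun o => F (o.X₁, o.X₂, o.X₃, o.Y₃)) =
      entropy (W.outcomeProb P') (fun o => F (o.X₁, o.X₂, o.X₃, o.Y₃)) := by
  classical
  have : ∀ a, law (W.outcomeProb P) (fun o => F (o.X₁, o.X₂, o.X₃, o.Y₃)) a =
      law (W.outcomeProb P') (fun o => F (o.X₁, o.X₂, o.X₃, o.Y₃)) a := by
    intro a
    have h1 := sum_outcomeProb_mul_output W P fun x => if F x = a then 1 else 0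
    have h2 := sum_outcomeProb_mul_output W P' fun x => if F x = a then 1 else 0
    rw [h] at h1
    have h3 := h1.trans h2.symm
    simpa [law] using h3
  simp only [entropy, this]

lemma condMutualInfo_output_congr (h : inputLaw P = inputLaw P') {α β : Type*} [Fintype α]
    [Fintype β] (F : ZMod q × ZMod q × ZMod q → α) (G : ZMod q × ZMod q × ZMod q → β) :
    condMutualInfo (W.outcomeProb P) (fun o => F (o.X₁, o.X₂, o.X₃)) (·.Y₃)
        (fun o => G (o.X₁, o.X₂, o.X₃)) =
      condMutualInfo (W.outcomeProb P') (fun o => F (o.X₁, o.X₂, o.X₃)) (·.Y₃)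
        (fun o => G (o.X₁, o.X₂, o.X₃)) := by
  have h1 := entropy_output_congr W h fun x => (F (x.1, x.2.1, x.2.2.1), G (x.1, x.2.1, x.2.2.1))
  have h2 := entropy_output_congr W h fun x => G (x.1, x.2.1, x.2.2.1)
  have h3 := entropy_output_congr W h fun x =>
    (F (x.1, x.2.1, x.2.2.1), x.2.2.2, G (x.1, x.2.1, x.2.2.1))
  have h4 := entropy_output_congr W h fun x => (x.2.2.2, G (x.1, x.2.1, x.2.2.1))
  simp only at h1 h2 h3 h4
  simp only [condMutualInfo, condEntropy, h1, h2, h3, h4]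

/-- The multiple-access bounds depend only on the input law, the bound on R₃₁ only on H(X₃ + Z₁ |
V). The bound on R₃₂ is H(X₃ + Z₁ + Z₂), fixed by the law of X₃, minus H(X₃ + Z₁ + Z₂ | V), so an
inequality in `h2` is enough. -/
lemma rateRegion_subset (hP : P ∈ stdSimplex ℝ (ZMod q × ZMod q × ZMod q × 𝒱))
    (hP' : P' ∈ stdSimplex ℝ (ZMod q × ZMod q × ZMod q × 𝒱'))
    (h : inputLaw P = inputLaw P') (hx : ∀ x, ∑ v, auxLaw P v x = ∑ v, auxLaw P' v x)
    (h1 : ∑ v, W.condTerm (fun z => z.1) (auxLaw P v) =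
      ∑ v, W.condTerm (fun z => z.1) (auxLaw P' v))
    (h2 : ∑ v, W.condTerm (fun z => z.1 + z.2) (auxLaw P' v) ≤
      ∑ v, W.condTerm (fun z => z.1 + z.2) (auxLaw P v)) :
    rateRegion W P ⊆ rateRegion W P' := by
  rintro ⟨R₁₃, R₂₃, R₃₁, R₃₂⟩ ⟨p1, p2, p3, p4, b1, b2, b3, b4, b5⟩
  refine ⟨p1, p2, p3, p4, ?_, ?_, ?_, ?_, ?_⟩
  · exact b1.trans_eq (condMutualInfo_output_congr W h (fun x => x.1) fun x => (x.2.1, x.2.2))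
  · exact b2.trans_eq (condMutualInfo_output_congr W h (fun x => x.2.1) fun x => (x.1, x.2.2))
  · exact b3.trans_eq (condMutualInfo_output_congr W h (fun x => (x.1, x.2.1)) fun x => x.2.2)
  · rw [condMutualInfo_input₃ W hP, condEntropy_noise_aux W P fun z => z.1, h1] at b4
    rw [condMutualInfo_input₃ W hP', condEntropy_noise_aux W P' fun z => z.1]
    exact b4
  · have e := entropy_noise_congr W hx fun z => z.1 + z.2
    rw [← condEntropy_noise_aux, ← condEntropy_noise_aux] at h2
    simp only [← add_assoc] at e h2
    rw [mutualInfo_symm] at b5 ⊢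
    linarith

/-- An auxiliary alphabet with `q + 1` elements suffices. -/
lemma exists_small_aux (hP : P ∈ stdSimplex ℝ (ZMod q × ZMod q × ZMod q × 𝒱)) :
    ∃ k ≤ q + 1, ∃ P' ∈ stdSimplex ℝ (ZMod q × ZMod q × ZMod q × Fin k),
      rateRegion W P ⊆ rateRegion W P' := by
  classical
  have hρ0 : ∀ v x, 0 ≤ auxLaw P v x := fun v x =>
    sum_nonneg fun _ _ => sum_nonneg fun _ _ => hP.1 _
  have hI0 : ∀ x₁ x₂ x₃, 0 ≤ inputLaw P x₁ x₂ x₃ := fun _ _ _ => sum_nonneg fun _ _ => hP.1 _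
  have hzero : ∀ v, ¬ 0 < ∑ x, auxLaw P v x → ∀ x, auxLaw P v x = 0 := fun v hv x =>
    (sum_eq_zero_iff_of_nonneg fun x _ => hρ0 v x).1
      (le_antisymm (not_lt.1 hv) (sum_nonneg fun x _ => hρ0 v x)) x (mem_univ x)
  have hterm : ∀ f v, ¬ 0 < ∑ x, auxLaw P v x → W.condTerm f (auxLaw P v) = 0 := by
    intro f v hv
    simp [Channel.condTerm, massEntropy, hzero v hv]
  -- The q + 1 preserved quantities: `some x` for the law of X₃, `none` for H(X₃ + Z₁ | V). `φ` adds
  -- up the law of X₃ and yields the mass of `v`; symbols of mass zero start with weight zero so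
  -- that it is positive on the support.
  obtain ⟨w, hw0, hwcard, hwA, hwg⟩ := exists_small_support
    (fun (v : 𝒱) (k : Option (ZMod q)) =>
      k.elim (W.condTerm (fun z => z.1) (auxLaw P v)) (auxLaw P v))
    (fun k => k.elim 0 fun _ => 1) (fun v => W.condTerm (fun z => z.1 + z.2) (auxLaw P v))
    (fun v => if 0 < ∑ x, auxLaw P v x then 1 else 0) (fun v => by split_ifs <;> norm_num)
    (fun v hv => by
      have : 0 < ∑ x, auxLaw P v x := by
        by_contra h
        simp [h] at hv
      simpa [Fintype.sum_option] using this)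
  have hind : ∀ F : 𝒱 → ℝ, (∀ v, ¬ 0 < ∑ x, auxLaw P v x → F v = 0) →
      ∑ v, (if 0 < ∑ x, auxLaw P v x then (1 : ℝ) else 0) * F v = ∑ v, F v := by
    intro F hF
    refine sum_congr rfl fun v _ => ?_
    split_ifs with h
    · rw [one_mul]
    · rw [hF v h, mul_zero]
  rw [hind _ (hterm _)] at hwg
  have hw1 := hwA none
  simp only [Option.elim] at hw1
  rw [hind _ (hterm _)] at hw1
  have hwx : ∀ x, ∑ v, w v * auxLaw P v x = ∑ v, auxLaw P v x := by
    intro x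
    have := hwA (some x)
    simp only [Option.elim] at this
    rw [this, hind _ fun v hv => hzero v hv x]
  set s : Finset 𝒱 := {v | w v ≠ 0} with hs
  have hsum : ∀ F : 𝒱 → ℝ,
      ∑ j : Fin #s, w (s.equivFin.symm j) * F (s.equivFin.symm j) = ∑ v, w v * F v := by
    intro F
    rw [s.equivFin.symm.sum_comp fun v : s => w v * F v, Finset.sum_coe_sort s fun v => w v * F v]
    refine Finset.sum_subset (Finset.subset_univ s) fun v _ hv => ?_
    have : w v = 0 := by simpa [hs] using hv
    rw [this, zero_mul]
  set T : ZMod q → ℝ := fun x => ∑ v, auxLaw P v x with hT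
  have hT' : ∀ x, ∑ x₁, ∑ x₂, inputLaw P x₁ x₂ x = T x := by
    intro x
    simp only [hT, inputLaw, auxLaw]
    rw [sum_comm]
    calc _ = ∑ x₂, ∑ v, ∑ x₁, P (x₁, x₂, x, v) := sum_congr rfl fun _ _ => sum_comm
      _ = ∑ v, ∑ x₂, ∑ x₁, P (x₁, x₂, x, v) := sum_comm
      _ = _ := sum_congr rfl fun _ _ => sum_comm
  have hT0 : ∀ x, 0 ≤ T x := fun x => sum_nonneg fun v _ => hρ0 v x
  -- The reweighted law of (V, X₃) is extended by the original conditional law of (X₁, X₂) given X₃,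
  -- which keeps the full input law.
  set P' : ZMod q × ZMod q × ZMod q × Fin #s → ℝ := fun a =>
    inputLaw P a.1 a.2.1 a.2.2.1 / T a.2.2.1 *
      (w (s.equivFin.symm a.2.2.2) * auxLaw P (s.equivFin.symm a.2.2.2) a.2.2.1) with hP'
  have hin : inputLaw P' = inputLaw P := by
    funext x₁ x₂ x₃
    rw [inputLaw]
    simp only [hP', ← mul_sum]
    rw [hsum fun v => auxLaw P v x₃, hwx]
    -- If X₃ = x₃ has probability zero, the quotient is zero by convention and the input law
    -- vanishes there too.
    by_cases h : T x₃ = 0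
    · have h1 := hT' x₃
      rw [h, sum_eq_zero_iff_of_nonneg fun _ _ => sum_nonneg fun _ _ => hI0 _ _ _] at h1
      have h2 := h1 x₁ (mem_univ _)
      rw [sum_eq_zero_iff_of_nonneg fun _ _ => hI0 _ _ _] at h2
      rw [h2 x₂ (mem_univ _)]
      simp
    · exact div_mul_cancel₀ _ h
  have haux : ∀ j, auxLaw P' j =
      fun x => w (s.equivFin.symm j) * auxLaw P (s.equivFin.symm j) x := by
    intro j
    funext x
    rw [auxLaw]
    simp only [hP', ← sum_mul, ← sum_div, hT']
    by_cases h : T x = 0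
    · have := (sum_eq_zero_iff_of_nonneg fun v _ => hρ0 v x).1 h (s.equivFin.symm j) (mem_univ _)
      simp [this]
    · rw [div_self h, one_mul]
  have htot : ∀ {𝒰 : Type _} [Fintype 𝒰] (Q : ZMod q × ZMod q × ZMod q × 𝒰 → ℝ),
      ∑ a, Q a = ∑ x₁, ∑ x₂, ∑ x₃, inputLaw Q x₁ x₂ x₃ := by
    intro 𝒰 _ Q
    simp only [Fintype.sum_prod_type (α₁ := ZMod q), inputLaw]
  have hmem : P' ∈ stdSimplex ℝ (ZMod q × ZMod q × ZMod q × Fin #s) := by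
    refine ⟨fun a => mul_nonneg (div_nonneg (hI0 _ _ _) (hT0 _)) (mul_nonneg (hw0 _) (hρ0 _ _)),
      ?_⟩
    have h1 : ∑ a, P a = ∑ x₁, ∑ x₂, ∑ x₃, inputLaw P x₁ x₂ x₃ := by
      simp only [Fintype.sum_prod_type (α₁ := ZMod q), inputLaw]
    rw [htot, hin, ← h1, hP.2]
  refine ⟨#s, ?_, P', hmem, rateRegion_subset W hP hmem hin.symm (fun x => ?_) ?_ ?_⟩
  · simpa using hwcard
  · simp only [haux]
    rw [hsum fun v => auxLaw P v x, hwx]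
  · simp only [haux, Channel.condTerm_smul]
    rw [hsum fun v => W.condTerm (fun z => z.1) (auxLaw P v), hw1]
  · simp only [haux, Channel.condTerm_smul]
    rw [hsum fun v => W.condTerm (fun z => z.1 + z.2) (auxLaw P v)]
    exact hwg

end Cardinality

/-! ### Letting the block length grow -/

section Limit

variable {q : ℕ} [NeZero q] {𝒴 : Type*} [Fintype 𝒴] {n : ℕ} {R₁₃ R₂₃ R₃₁ R₃₂ : ℝ}

lemma card_msg_pos {R : ℝ} (hR : 0 ≤ R) : 0 < Fintype.card (Msg n R) := by
  rw [Fintype.card_fin]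
  exact Nat.floor_pos.2 (one_le_rpow (by norm_num) (by positivity))

/-- Since the floor is at least one, 2^{nR} is at most twice the floor: rounding costs at most one
bit. -/
lemma le_logb_card_msg {R : ℝ} (hR : 0 ≤ R) : n * R - 1 ≤ logb 2 (Fintype.card (Msg n R)) := by
  have h0 : (0 : ℝ) < Fintype.card (Msg n R) := by exact_mod_cast card_msg_pos hR
  have h1 : (1 : ℝ) ≤ Fintype.card (Msg n R) := by exact_mod_cast card_msg_pos hR
  have h2 : (2 : ℝ) ^ (n * R) ≤ 2 * Fintype.card (Msg n R) := by
    have := (Nat.lt_floor_add_one ((2 : ℝ) ^ (n * R))).le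
    rw [Fintype.card_fin] at h1 ⊢
    linarith
  have h3 := logb_le_logb_of_le (b := 2) (by norm_num) (by positivity) h2
  rw [logb_rpow (by norm_num) (by norm_num), logb_mul (by norm_num) h0.ne',
    logb_self_eq_one (by norm_num)] at h3
  linarith

lemma sum_sampleProb (W : Channel q 𝒴) (c : Code q 𝒴 n R₁₃ R₂₃ R₃₁ R₃₂) (h₁₃ : 0 ≤ R₁₃)
    (h₂₃ : 0 ≤ R₂₃) (h₃₁ : 0 ≤ R₃₁) (h₃₂ : 0 ≤ R₃₂) : ∑ ω, sampleProb W c ω = 1 := by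
  have h : (Fintype.card (Msgs n R₁₃ R₂₃ R₃₁ R₃₂) : ℝ) ≠ 0 := by
    simp only [Fintype.card_prod, Nat.cast_ne_zero]
    have h1 := card_msg_pos (n := n) h₁₃
    have h2 := card_msg_pos (n := n) h₂₃
    have h3 := card_msg_pos (n := n) h₃₁
    have h4 := card_msg_pos (n := n) h₃₂
    positivity
  rw [← sum_law (sampleProb W c) Prod.fst]
  simp only [law_sampleProb_messages, sum_const, card_univ, nsmul_eq_mul]
  exact mul_inv_cancel₀ h

lemma errorProb_nonneg (W : Channel q 𝒴) (c : Code q 𝒴 n R₁₃ R₂₃ R₃₁ R₃₂) :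
    0 ≤ errorProb W c := by
  simpa using sum_ite_le_errorProb W c (fun _ => False) (by simp)

/-- The rates of a code, reduced by a small amount, lie in a single rate region. -/
lemma exists_mem_rateRegion (W : Channel q 𝒴) (c : Code q 𝒴 n R₁₃ R₂₃ R₃₁ R₃₂) (hn : 0 < n)
    (h₁₃ : 0 ≤ R₁₃) (h₂₃ : 0 ≤ R₂₃) (h₃₁ : 0 ≤ R₃₁) (h₃₂ : 0 ≤ R₃₂) (hE : errorProb W c ≤ 1)
    {ε : ℝ} (hε : ε = errorProb W c * (R₁₃ + R₂₃ + R₃₁ + R₃₂) + 3 / n) :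
    ∃ k ≤ q + 1, ∃ P ∈ stdSimplex ℝ (ZMod q × ZMod q × ZMod q × Fin k),
      (max (R₁₃ - ε) 0, max (R₂₃ - ε) 0, max (R₃₁ - ε) 0, max (R₃₂ - ε) 0) ∈ rateRegion W P := by
  have hp1 := sum_sampleProb W c h₁₃ h₂₃ h₃₁ h₃₂
  have hE0 := errorProb_nonneg W c
  obtain ⟨P, hP, b1, b2, b3, b4, b5⟩ := exists_single_letter W c hn hp1
  obtain ⟨k, hk, P', hP', hsub⟩ := exists_small_aux W hP
  refine ⟨k, hk, P', hP', hsub ?_⟩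
  set E := errorProb W c with hEdef
  have hn' : (0 : ℝ) < n := by positivity
  have hμ := outcomeProb_nonneg W hP.1
  have hμ1 := sum_outcomeProb W hP.2
  have hcard : logb 2 (Fintype.card (Msg n R₁₃ × Msg n R₂₃)) =
      logb 2 (Fintype.card (Msg n R₁₃)) + logb 2 (Fintype.card (Msg n R₂₃)) := by
    rw [Fintype.card_prod, Nat.cast_mul, logb_mul]
    · exact_mod_cast (card_msg_pos h₁₃).ne'
    · exact_mod_cast (card_msg_pos h₂₃).ne'
  -- The 3 in `ε` is one bit from Fano plus two from rounding, as the sum-rate bound involves two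
  -- message sets.
  have key : ∀ {R L I : ℝ}, R ≤ R₁₃ + R₂₃ + R₃₁ + R₃₂ → n * R - 2 ≤ L →
      (1 - E) * L - 1 ≤ n * I → R - ε ≤ I := by
    intro R L I h1 h2 h3
    have h4 : (1 - E) * (n * R - 2) ≤ (1 - E) * L := mul_le_mul_of_nonneg_left h2 (by linarith)
    have h5 : E * R ≤ E * (R₁₃ + R₂₃ + R₃₁ + R₃₂) := mul_le_mul_of_nonneg_left h1 hE0
    have h6 : n * (R - E * R) - 3 ≤ n * I := by nlinarith
    have h7 : R - E * R - 3 / n ≤ I := by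
      rw [← mul_le_mul_iff_right₀ hn', mul_sub, mul_div_cancel₀ _ hn'.ne']
      exact h6
    linarith
  have e13 := le_logb_card_msg (n := n) h₁₃
  have e23 := le_logb_card_msg (n := n) h₂₃
  have e31 := le_logb_card_msg (n := n) h₃₁
  have e32 := le_logb_card_msg (n := n) h₃₂
  have c1 := key (R := R₁₃) (by linarith) (by linarith) b1
  have c2 := key (R := R₂₃) (by linarith) (by linarith) b2
  have c3 := key (R := R₁₃ + R₂₃) (by linarith) (by rw [hcard]; linarith) b3
  have c4 := key (R := R₃₁) (by linarith) (by linarith) b4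
  have c5 := key (R := R₃₂) (by linarith) (by linarith) b5
  have hε0 : 0 ≤ ε := by rw [hε]; positivity
  have n3 : 0 ≤ condMutualInfo (W.outcomeProb P) (fun ω => (ω.X₁, ω.X₂)) (·.Y₃) (·.X₃) :=
    condMutualInfo_nonneg hμ _ _ _
  refine ⟨le_max_right _ _, le_max_right _ _, le_max_right _ _, le_max_right _ _,
    max_le c1 (condMutualInfo_nonneg hμ _ _ _), max_le c2 (condMutualInfo_nonneg hμ _ _ _), ?_,
    max_le c4 (condMutualInfo_nonneg hμ _ _ _), max_le c5 (mutualInfo_nonneg hμ hμ1 _ _)⟩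
  -- The sum-rate bound `c3` allows a single `ε`. Subtracting it twice is harmless, and a rate
  -- truncated to zero is dropped because the original rates are nonnegative; if both are truncated,
  -- `n3` applies.
  rcases max_cases (R₁₃ - ε) 0 with ⟨h1, -⟩ | ⟨h1, -⟩ <;>
    rcases max_cases (R₂₃ - ε) 0 with ⟨h2, -⟩ | ⟨h2, -⟩ <;> rw [h1, h2] <;> linarith

end Limit

end MADB

theorem theorem12 {q : ℕ} [NeZero q] (hq : 2 ≤ q) {𝒴 : Type*} [Fintype 𝒴]
    (W : MADB.Channel q 𝒴) (R₁₃ R₂₃ R₃₁ R₃₂ : ℝ)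
    (hR : MADB.Achievable W R₁₃ R₂₃ R₃₁ R₃₂) :
    (R₁₃, R₂₃, R₃₁, R₃₂) ∈ MADB.outerBound W := by
  obtain ⟨h₁₃, h₂₃, h₃₁, h₃₂, c, hc⟩ := hR
  set ε : ℕ → ℝ := fun n => MADB.errorProb W (c n) * (R₁₃ + R₂₃ + R₃₁ + R₃₂) + 3 / n with hε
  have hlim : Filter.Tendsto ε Filter.atTop (nhds 0) := by
    simpa using (hc.mul_const (R₁₃ + R₂₃ + R₃₁ + R₃₂)).add
      (tendsto_const_div_atTop_nhds_zero_nat (3 : ℝ))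
  have hmax : ∀ R : ℝ, 0 ≤ R →
      Filter.Tendsto (fun n => max (R - ε n) 0) Filter.atTop (nhds R) := by
    intro R h
    simpa [h] using (hlim.const_sub R).max (tendsto_const_nhds (x := (0 : ℝ)))
  refine mem_closure_of_tendsto ((hmax R₁₃ h₁₃).prodMk_nhds ((hmax R₂₃ h₂₃).prodMk_nhds
    ((hmax R₃₁ h₃₁).prodMk_nhds (hmax R₃₂ h₃₂)))) ?_
  -- An error probability of at most one keeps the factor 1 - E in the converse nonnegative.
  filter_upwards [hc.eventually_le_const one_pos, Filter.eventually_gt_atTop 0] with n hn hn0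
  exact subset_convexHull ℝ _
    (MADB.exists_mem_rateRegion W (c n) hn0 h₁₃ h₂₃ h₃₁ h₃₂ hn rfl)
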